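/- **Theorem (Blow-up by isolated mass group).** Let $c>0$, $k>0$, $\gamma\ge 1$, $P(\rho)=k^2\rho^\gamma$, and consider in $\mathbb{R}^3$ the relativistic Euler equations $$\hat\rho_t+\operatorname{div}(\tilde\rho u)=0,\qquad (\tilde\rho u)_t+\operatorname{div}(\tilde\rho\, u\otimes u)+\nabla P=0,\qquad (\rho,u)|_{t=0}=(\rho_0,u_0),$$ $$\hat\rho=\frac{\rho+P|u|^2/c^4}{1-|u|^2/c^2},\qquad \tilde\rho=\frac{\rho+P/c^2}{1-|u|^2/c^2}.$$ For $T>0$, a pair $(\rho,u)$ is called a *regular solution* in $[0,T]\times\mathbb{R}^3$ if it satisfies this problem (the equations in the sense of distributions, the initial condition pointwise) and on $[0,T]\times\mathbb{R}^3$: (A) $\rho\ge 0$ and $(\rho,u)\in C^1([0,T]\times\mathbb{R}^3)$; (B) $|u|<c$ and $\sqrt{P'(\rho)}<c$; (C) $u_t+u\cdot\nabla u=0$ whenever $\rho(t,x)=0$. The maximal existence time $T_m\in[0,\infty]$ is the supremum of all $T$ for which a regular solution in $[0,T]\times\mathbb{R}^3$ with data $(\rho_0,u_0)$ exists. Suppose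 that the initial data $(\rho_0,u_0)$ have an *isolated mass group* $(A_0,B_0)$, that is, $A_0,B_0\subset\mathbb{R}^3$ are connected bounded open sets with smooth boundary such that $\overline{A_0}\subset B_0\subseteq B_{R_0}$ for some $R_0>0$, where $B_{R_0}$ is the ball of radius $R_0$ centered at the origin; $\rho_0=0$ on $B_0\setminus A_0$; $\int_{A_0}\rho_0\,dx>0$; $u_0$ equals a constant vector $\bar u_0$ on $\partial A_0$; and $$\int_{A_0}\tilde\rho_0\,u_0\,dx=0,\qquad\text{where } \tilde\rho_0=\frac{\rho_0+P(\rho_0)/c^2}{1-|u_0|^2/c^2}.$$ Then $T_m<+\infty$. In particular, no regular solution with these data exists for all times. -/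

import Mathlib

noncomputable section

namespace RelEuler

open MeasureTheory Set
open scoped ContDiff ENNReal Topology

/-- Physical space, with the Euclidean norm. -/
abbrev E3 : Type := EuclideanSpace ℝ (Fin 3)

/-- The pressure law `P(ρ) = k² ρ^γ`. -/
def pressure (k γ : ℝ) (r : ℝ) : ℝ := k ^ 2 * r ^ γ

/-- `ρ̂ = (ρ + P |u|² / c⁴) / (1 - |u|² / c²)`, as a function of the values `r` of the
mass-energy density and `v` of the velocity. -/
def rhoHat (c k γ : ℝ) (r : ℝ) (v : E3) : ℝ :=
  (r + pressure k γ r * ‖v‖ ^ 2 / c ^ 4) / (1 - ‖v‖ ^ 2 / c ^ 2)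

/-- `ρ̃ = (ρ + P / c²) / (1 - |u|² / c²)`, as a function of the values `r` of the
mass-energy density and `v` of the velocity. -/
def rhoTilde (c k γ : ℝ) (r : ℝ) (v : E3) : ℝ :=
  (r + pressure k γ r / c ^ 2) / (1 - ‖v‖ ^ 2 / c ^ 2)

/-- The time derivative of a function on space-time. -/
def dt (φ : ℝ × E3 → ℝ) (z : ℝ × E3) : ℝ := fderiv ℝ φ z (1, 0)

/-- The spatial derivative `v · ∇φ` in the direction `v` of a function on space-time. -/
def dx (φ : ℝ × E3 → ℝ) (z : ℝ × E3) (v : E3) : ℝ := fderiv ℝ φ z (0, v)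

/-- Smooth test functions with compact support in `(0, T) × ℝ³`. -/
structure IsTestFunction (T : ℝ) (φ : ℝ × E3 → ℝ) : Prop where
  smooth : ContDiff ℝ ∞ φ
  compact : HasCompactSupport φ
  support : tsupport φ ⊆ Ioo 0 T ×ˢ univ

/-- The energy equation `ρ̂_t + div (ρ̃ u) = 0` in the sense of distributions on
`(0, T) × ℝ³`. -/
def WeakEnergy (c k γ T : ℝ) (ρ : ℝ → E3 → ℝ) (u : ℝ → E3 → E3) : Prop :=
  ∀ φ : ℝ × E3 → ℝ, IsTestFunction T φ →
    ∫ z : ℝ × E3,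
      (rhoHat c k γ (ρ z.1 z.2) (u z.1 z.2) * dt φ z
        + rhoTilde c k γ (ρ z.1 z.2) (u z.1 z.2) * dx φ z (u z.1 z.2)) = 0

/-- The momentum equation `(ρ̃ u)_t + div (ρ̃ u ⊗ u) + ∇P = 0`, component by component, in the
sense of distributions on `(0, T) × ℝ³`. -/
def WeakMomentum (c k γ T : ℝ) (ρ : ℝ → E3 → ℝ) (u : ℝ → E3 → E3) : Prop :=
  ∀ φ : ℝ × E3 → ℝ, IsTestFunction T φ → ∀ i : Fin 3,
    ∫ z : ℝ × E3,
      (rhoTilde c k γ (ρ z.1 z.2) (u z.1 z.2) * u z.1 z.2 i * dt φ z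
        + rhoTilde c k γ (ρ z.1 z.2) (u z.1 z.2) * u z.1 z.2 i * dx φ z (u z.1 z.2)
        + pressure k γ (ρ z.1 z.2) * dx φ z (EuclideanSpace.single i 1)) = 0

/-- `(ρ, u)` is a regular solution in `[0, T] × ℝ³` of the Cauchy problem with data `(ρ₀, u₀)`.
The values of `ρ t` and `u t` for `t` outside `[0, T]` are irrelevant; derivatives in time at the
endpoints are one-sided. -/
structure IsRegularSolution (c k γ : ℝ) (ρ₀ : E3 → ℝ) (u₀ : E3 → E3) (T : ℝ)
    (ρ : ℝ → E3 → ℝ) (u : ℝ → E3 → E3) : Prop where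
  pos_time : 0 < T
  weak_energy : WeakEnergy c k γ T ρ u
  weak_momentum : WeakMomentum c k γ T ρ u
  init_density : ∀ x, ρ 0 x = ρ₀ x
  init_velocity : ∀ x, u 0 x = u₀ x
  density_nonneg : ∀ t ∈ Icc 0 T, ∀ x, 0 ≤ ρ t x
  density_c1 : ContDiffOn ℝ 1 (fun z : ℝ × E3 => ρ z.1 z.2) (Icc 0 T ×ˢ univ)
  velocity_c1 : ContDiffOn ℝ 1 (fun z : ℝ × E3 => u z.1 z.2) (Icc 0 T ×ˢ univ)
  subluminal : ∀ t ∈ Icc 0 T, ∀ x, ‖u t x‖ < c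
  sound_speed : ∀ t ∈ Icc 0 T, ∀ x, Real.sqrt (deriv (pressure k γ) (ρ t x)) < c
  vacuum_eq : ∀ t ∈ Icc 0 T, ∀ x, ρ t x = 0 →
    derivWithin (fun s => u s x) (Icc 0 T) t + fderiv ℝ (u t) x (u t x) = 0

/-- The maximal existence time `T_m ∈ [0, ∞]`: the supremum of all `T` such that a regular
solution with data `(ρ₀, u₀)` exists in `[0, T] × ℝ³`. -/
def maximalTime (c k γ : ℝ) (ρ₀ : E3 → ℝ) (u₀ : E3 → E3) : ℝ≥0∞ :=
  sSup {τ | ∃ T : ℝ, τ = ENNReal.ofReal T ∧ ∃ ρ u, IsRegularSolution c k γ ρ₀ u₀ T ρ u}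

/-- An open set has smooth boundary if near each boundary point it is the sublevel set
`{φ < 0}` of a smooth function `φ` whose differential does not vanish there. -/
def HasSmoothBoundary (A : Set E3) : Prop :=
  ∀ p ∈ frontier A, ∃ φ : E3 → ℝ, ContDiff ℝ ∞ φ ∧ fderiv ℝ φ p ≠ 0 ∧
    ∀ᶠ x in 𝓝 p, (x ∈ A ↔ φ x < 0)

/-- The data `(ρ₀, u₀)` have the isolated mass group `(A₀, B₀)`. Boundedness of both sets is
contained in `A₀ ⊆ closure A₀ ⊆ B₀ ⊆ B_{R₀}`. -/
structure IsIsolatedMassGroup (c k γ : ℝ) (ρ₀ : E3 → ℝ) (u₀ : E3 → E3)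
    (A₀ B₀ : Set E3) : Prop where
  isOpen_A : IsOpen A₀
  isOpen_B : IsOpen B₀
  connected_A : IsConnected A₀
  connected_B : IsConnected B₀
  smooth_A : HasSmoothBoundary A₀
  smooth_B : HasSmoothBoundary B₀
  closure_subset : closure A₀ ⊆ B₀
  bounded : ∃ R₀ : ℝ, 0 < R₀ ∧ B₀ ⊆ Metric.ball 0 R₀
  vacuum : ∀ x ∈ B₀ \ A₀, ρ₀ x = 0
  mass_pos : 0 < ∫ x in A₀, ρ₀ x
  velocity_const : ∃ ubar : E3, ∀ x ∈ frontier A₀, u₀ x = ubar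
  momentum_zero : ∫ x in A₀, rhoTilde c k γ (ρ₀ x) (u₀ x) • u₀ x = 0

end RelEuler

end

/-!
Vacuum is transported along particle paths, and a boundary particle of `A₀`, which lies in vacuum,
feels no force and moves in a straight line with the common velocity `w` of the boundary. Hence the
mass group is translated with velocity `w` and stays surrounded by a collar of vacuum. In the frame
moving with `w`, the energy `ρ̂` and the components of `ρ̃ u - ρ̂ w` are densities of conserved
currents confined to `A₀`, and the flux of the energy is that relative momentum density. So the
second moment of the energy stays between `0` and `R² E`, where `A₀` has radius at most `R` and `E`
is the total energy, while its second time derivative is twice the integral of the trace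
`ρ̃ |u - w|² + (3 - |w|² / c²) P` of the momentum flux. If `|u|` is near `c` then `|u - w|` is
bounded below; otherwise `ρ̂` is controlled by `ρ`, and `ρ ≤ l + P / (k² l ^ (γ - 1))` for every
`l > 0`. For `l` small compared with `E / |A₀|` the second derivative is therefore at least a
positive multiple of `E`, uniformly in time, which a function with values in `[0, R² E]` allows only
on a time interval of bounded length.
-/

noncomputable section

namespace RelEuler

open MeasureTheory Set Filter
open scoped ContDiff ENNReal Topology

/-! ### Differential inequalities -/

section Gronwall

variable {F : Type*} [NormedAddCommGroup F] [NormedSpace ℝ F] {f f' : ℝ → F} {a b K : ℝ}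

lemma norm_right_le_exp_mul_norm_left (hf : ContinuousOn f (Icc a b))
    (hf' : ∀ s ∈ Ioo a b, HasDerivAt f (f' s) s) (hb : ∀ s ∈ Ioo a b, ‖f' s‖ ≤ K * ‖f s‖)
    (hab : a ≤ b) : ‖f b‖ ≤ Real.exp (K * (b - a)) * ‖f a‖ := by
  rcases hab.eq_or_lt with rfl | hab
  · simp
  have hinner : ∀ s ∈ Ioo a b, ‖f b‖ ≤ Real.exp (K * (b - s)) * ‖f s‖ := by
    intro s hs
    have := norm_le_gronwallBound_of_norm_deriv_right_le (ε := 0)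
      (hf.mono (Icc_subset_Icc_left hs.1.le))
      (fun x hx => (hf' x ⟨hs.1.trans_le hx.1, hx.2⟩).hasDerivWithinAt) le_rfl
      (fun x hx => by simpa using hb x ⟨hs.1.trans_le hx.1, hx.2⟩) b ⟨hs.2.le, le_rfl⟩
    rwa [gronwallBound_ε0, mul_comm] at this
  refine le_on_closure (f := fun _ => ‖f b‖) hinner continuousOn_const ?_
    (closure_Ioo hab.ne ▸ left_mem_Icc.2 hab.le)
  rw [closure_Ioo hab.ne]
  exact ContinuousOn.mul (by fun_prop) hf.norm

lemma norm_left_le_exp_mul_norm_right (hf : ContinuousOn f (Icc a b))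
    (hf' : ∀ s ∈ Ioo a b, HasDerivAt f (f' s) s) (hb : ∀ s ∈ Ioo a b, ‖f' s‖ ≤ K * ‖f s‖)
    (hab : a ≤ b) : ‖f a‖ ≤ Real.exp (K * (b - a)) * ‖f b‖ := by
  have hIoo : ∀ s ∈ Ioo (-b) (-a), -s ∈ Ioo a b := fun s hs => ⟨lt_neg.2 hs.2, neg_lt.2 hs.1⟩
  have := norm_right_le_exp_mul_norm_left (f := fun s => f (-s)) (f' := fun s => -f' (-s))
    (hf.comp continuous_neg.continuousOn fun s hs => ⟨le_neg.2 hs.2, neg_le.2 hs.1⟩)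
    (fun s hs => ((hf' (-s) (hIoo s hs)).scomp s (hasDerivAt_neg s)).congr_deriv (by simp))
    (fun s hs => by simpa using hb (-s) (hIoo s hs)) (neg_le_neg hab)
  simpa [neg_add_eq_sub] using this

lemma norm_le_exp_mul_norm_of_norm_deriv_le (hK : 0 ≤ K) (hf : ContinuousOn f (Icc a b))
    (hf' : ∀ s ∈ Ioo a b, HasDerivAt f (f' s) s) (hb : ∀ s ∈ Ioo a b, ‖f' s‖ ≤ K * ‖f s‖)
    {s t : ℝ} (hs : s ∈ Icc a b) (ht : t ∈ Icc a b) :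
    ‖f t‖ ≤ Real.exp (K * (b - a)) * ‖f s‖ := by
  rcases le_total s t with h | h
  · refine (norm_right_le_exp_mul_norm_left (hf.mono (Icc_subset_Icc hs.1 ht.2))
      (fun x hx => hf' x (Ioo_subset_Ioo hs.1 ht.2 hx))
      (fun x hx => hb x (Ioo_subset_Ioo hs.1 ht.2 hx)) h).trans ?_
    gcongr
    exacts [ht.2, hs.1]
  · refine (norm_left_le_exp_mul_norm_right (hf.mono (Icc_subset_Icc ht.1 hs.2))
      (fun x hx => hf' x (Ioo_subset_Ioo ht.1 hs.2 hx))
      (fun x hx => hb x (Ioo_subset_Ioo ht.1 hs.2 hx)) h).trans ?_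
    gcongr
    exacts [hs.2, ht.1]

lemma eq_of_hasDerivAt_zero (hf : ContinuousOn f (Icc a b))
    (hf' : ∀ s ∈ Ioo a b, HasDerivAt f 0 s) {s t : ℝ} (hs : s ∈ Icc a b) (ht : t ∈ Icc a b) :
    f t = f s := by
  have := norm_le_exp_mul_norm_of_norm_deriv_le (f := fun x => f x - f s) le_rfl
    (hf.sub continuousOn_const) (fun x hx => (hf' x hx).sub_const _) (by simp) hs ht
  rwa [sub_self, norm_zero, mul_zero, norm_le_zero_iff, sub_eq_zero] at this

end Gronwall

/-- Subtracting the parabola of second derivative `δ` leaves a convex function, which at the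
midpoint lies below the mean of its end values. -/
lemma mul_sq_le_of_le_deriv_deriv {a b δ B : ℝ} {f f' f'' : ℝ → ℝ} (hab : a ≤ b)
    (hf : ContinuousOn f (Icc a b)) (hf' : ∀ t ∈ Ioo a b, HasDerivAt f (f' t) t)
    (hf'' : ∀ t ∈ Ioo a b, HasDerivAt f' (f'' t) t) (hδ : ∀ t ∈ Ioo a b, δ ≤ f'' t)
    (hf0 : ∀ t ∈ Icc a b, 0 ≤ f t) (hfB : ∀ t ∈ Icc a b, f t ≤ B) :
    δ * (b - a) ^ 2 ≤ 8 * B := by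
  have hconv : ConvexOn ℝ (Icc a b) fun t => f t - δ / 2 * t ^ 2 := by
    refine convexOn_of_hasDerivWithinAt2_nonneg (convex_Icc a b) (f' := fun t => f' t - δ * t)
      (f'' := fun t => f'' t - δ) (hf.sub (by fun_prop)) ?_ ?_ ?_ <;> rw [interior_Icc] <;>
      intro t ht
    · refine ((hf' t ht).sub ((hasDerivAt_pow 2 t).const_mul (δ / 2))).hasDerivWithinAt.congr_deriv
        ?_
      norm_num
      ring
    · exact ((hf'' t ht).sub (hasDerivAt_const_mul δ)).hasDerivWithinAt
    · exact sub_nonneg.2 (hδ t ht)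
  have hmid : (1 / 2 : ℝ) * a + 1 / 2 * b ∈ Icc a b := ⟨by linarith, by linarith⟩
  have hmean := hconv.2 (left_mem_Icc.2 hab) (right_mem_Icc.2 hab) one_half_pos.le one_half_pos.le
    (add_halves 1)
  simp only [smul_eq_mul] at hmean
  linarith [hf0 _ hmid, hfB a (left_mem_Icc.2 hab), hfB b (right_mem_Icc.2 hab)]

/-! ### The divergence of a vector field -/

section Divergence

variable {X : Type*} [NormedAddCommGroup X] [NormedSpace ℝ X]

/-- The divergence of a vector field, defined without coordinates as the trace of its
derivative. -/
def divergence (F : X → X) (x : X) : ℝ :=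
  LinearMap.trace ℝ X (fderiv ℝ F x)

lemma divergence_sub {F G : X → X} {x : X} (hF : DifferentiableAt ℝ F x)
    (hG : DifferentiableAt ℝ G x) :
    divergence (fun y => F y - G y) x = divergence F x - divergence G x := by
  simp only [divergence, fderiv_fun_sub hF hG, ContinuousLinearMap.toLinearMap_sub, map_sub]

lemma divergence_add {F G : X → X} {x : X} (hF : DifferentiableAt ℝ F x)
    (hG : DifferentiableAt ℝ G x) :
    divergence (fun y => F y + G y) x = divergence F x + divergence G x := by
  simp only [divergence, fderiv_fun_add hF hG, ContinuousLinearMap.toLinearMap_add, map_add]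

lemma divergence_const_smul (a : ℝ) {F : X → X} {x : X} (hF : DifferentiableAt ℝ F x) :
    divergence (fun y => a • F y) x = a * divergence F x := by
  simp only [divergence, fderiv_fun_const_smul hF, ContinuousLinearMap.toLinearMap_smul, map_smul,
    smul_eq_mul]

lemma divergence_congr {F G : X → X} {x : X} (h : F =ᶠ[𝓝 x] G) :
    divergence F x = divergence G x := by
  rw [divergence, divergence, h.fderiv_eq]

lemma divergence_const (v x : X) : divergence (fun _ => v) x = 0 := by
  simp [divergence]

lemma divergence_conj (L : X ≃L[ℝ] X) {F : X → X} {x : X} (hF : DifferentiableAt ℝ F (L x)) :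
    divergence (fun y => L.symm (F (L y))) x = divergence F (L x) := by
  have h : HasFDerivAt (fun y => L.symm (F (L y)))
      ((L.symm : X →L[ℝ] X) ∘L fderiv ℝ F (L x) ∘L (L : X →L[ℝ] X)) x :=
    L.symm.hasFDerivAt.comp x (hF.hasFDerivAt.comp x L.hasFDerivAt)
  rw [divergence, h.fderiv, divergence,
    ← LinearMap.trace_conj' (fderiv ℝ F (L x) : X →ₗ[ℝ] X) L.symm.toLinearEquiv]
  rfl

lemma contDiff_smul_of_tsupport_subset {F : Type*} [NormedAddCommGroup F] [NormedSpace ℝ F]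
    {Ω : Set X} (hΩ : IsOpen Ω) {n : WithTop ℕ∞} {φ : X → ℝ} {f : X → F} (hφ : ContDiff ℝ n φ)
    (hf : ContDiffOn ℝ n f Ω) (hs : tsupport φ ⊆ Ω) : ContDiff ℝ n fun x => φ x • f x := by
  refine contDiff_iff_contDiffAt.2 fun x => ?_
  by_cases hx : x ∈ tsupport φ
  · exact hφ.contDiffAt.smul (hf.contDiffAt (hΩ.mem_nhds (hs hx)))
  · refine contDiffAt_const (c := (0 : F)).congr_of_eventuallyEq ?_
    filter_upwards [notMem_tsupport_iff_eventuallyEq.1 hx] with y hy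
    rw [hy, Pi.zero_apply, zero_smul]

variable [FiniteDimensional ℝ X]

lemma divergence_smul {f : X → ℝ} {F : X → X} {x : X} (hf : DifferentiableAt ℝ f x)
    (hF : DifferentiableAt ℝ F x) :
    divergence (fun y => f y • F y) x = f x * divergence F x + fderiv ℝ f x (F x) := by
  rw [divergence, fderiv_fun_smul hf hF, ContinuousLinearMap.toLinearMap_add, map_add]
  exact congrArg₂ (· + ·) (by rw [ContinuousLinearMap.toLinearMap_smul, map_smul]; rfl)
    (LinearMap.trace_smulRight (fderiv ℝ f x : X →ₗ[ℝ] ℝ) (F x))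

lemma divergence_smul_const {f : X → ℝ} {x : X} (hf : DifferentiableAt ℝ f x) (v : X) :
    divergence (fun y => f y • v) x = fderiv ℝ f x v := by
  rw [divergence_smul hf (differentiableAt_const v), divergence_const, mul_zero, zero_add]

variable (X) in
/-- The trace as a continuous linear functional on the endomorphisms of a finite-dimensional
space. -/
def traceL : (X →L[ℝ] X) →L[ℝ] ℝ :=
  LinearMap.toContinuousLinearMap (LinearMap.trace ℝ X ∘ₗ ContinuousLinearMap.coeLM ℝ)

lemma divergence_eq_traceL (F : X → X) (x : X) : divergence F x = traceL X (fderiv ℝ F x) := rfl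

lemma continuousOn_divergence {Ω : Set X} (hΩ : IsOpen Ω) {F : X → X}
    (hF : ContDiffOn ℝ 1 F Ω) : ContinuousOn (divergence F) Ω :=
  (traceL X).continuous.comp_continuousOn (hF.continuousOn_fderiv_of_isOpen hΩ le_rfl)

variable [MeasurableSpace X] [BorelSpace X] {μ : Measure X} [μ.IsAddHaarMeasure]

lemma integral_fderiv_apply_eq_zero {F : Type*} [NormedAddCommGroup F] [NormedSpace ℝ F]
    {f : X → F} (hf : ContDiff ℝ 1 f) (hc : HasCompactSupport f) (v : X) :
    ∫ x, fderiv ℝ f x v ∂μ = 0 := by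
  have hint : Integrable (fun x => fderiv ℝ f x v) μ :=
    ((hf.continuous_fderiv one_ne_zero).clm_apply continuous_const).integrable_of_hasCompactSupport
      (hc.fderiv_apply ℝ v)
  simpa using integral_smul_fderiv_eq_neg_fderiv_smul_of_integrable (μ := μ) (v := v)
    (f := fun _ : X => (1 : ℝ)) (g := f) (by simp) (by simpa using hint)
    (by simpa using hf.continuous.integrable_of_hasCompactSupport hc)
    (fun x _ => differentiableAt_const _) (fun x _ => hf.differentiable one_ne_zero x)

lemma integral_divergence_eq_zero {F : X → X} (hF : ContDiff ℝ 1 F) (hc : HasCompactSupport F) :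
    ∫ x, divergence F x ∂μ = 0 := by
  have hint : Integrable (fderiv ℝ F) μ :=
    (hF.continuous_fderiv one_ne_zero).integrable_of_hasCompactSupport (hc.fderiv ℝ)
  have hzero : ∫ x, fderiv ℝ F x ∂μ = 0 := by
    ext v
    rw [ContinuousLinearMap.integral_apply hint, integral_fderiv_apply_eq_zero hF hc]
    rfl
  simp_rw [divergence_eq_traceL]
  rw [(traceL X).integral_comp_comm hint, hzero, map_zero]

lemma integral_mul_divergence_eq_neg {Ω : Set X} (hΩ : IsOpen Ω) {φ : X → ℝ} {F : X → X}
    (hφ : ContDiff ℝ 1 φ) (hc : HasCompactSupport φ) (hs : tsupport φ ⊆ Ω)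
    (hF : ContDiffOn ℝ 1 F Ω) :
    ∫ x, φ x * divergence F x ∂μ = -∫ x, fderiv ℝ φ x (F x) ∂μ := by
  have hφF : ContDiff ℝ 1 fun x => φ x • F x := contDiff_smul_of_tsupport_subset hΩ hφ hF hs
  have hφFc : HasCompactSupport fun x => φ x • F x := hc.smul_right
  have hint : Integrable (fun x => φ x * divergence F x) μ :=
    (contDiff_zero.1 (contDiff_smul_of_tsupport_subset hΩ (contDiff_zero.2 hφ.continuous)
      (contDiffOn_zero.2 (continuousOn_divergence hΩ hF)) hs)).integrable_of_hasCompactSupport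
      hc.mul_right
  have hint' : Integrable (divergence fun x => φ x • F x) μ :=
    (traceL X).integrable_comp
      ((hφF.continuous_fderiv one_ne_zero).integrable_of_hasCompactSupport (hφFc.fderiv ℝ))
  have hleibniz : ∀ x, fderiv ℝ φ x (F x)
      = divergence (fun y => φ y • F y) x - φ x * divergence F x := by
    intro x
    by_cases hx : x ∈ tsupport φ
    · rw [divergence_smul (hφ.differentiable one_ne_zero x)
        ((hF.differentiableOn one_ne_zero).differentiableAt (hΩ.mem_nhds (hs hx)))]
      ring
    · have hφ0 : φ =ᶠ[𝓝 x] 0 := notMem_tsupport_iff_eventuallyEq.1 hx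
      have hφF0 : (fun y => φ y • F y) =ᶠ[𝓝 x] fun _ => 0 := by
        filter_upwards [hφ0] with y hy
        rw [hy, Pi.zero_apply, zero_smul]
      rw [divergence_congr hφF0, divergence_const, hφ0.fderiv_eq, hφ0.self_of_nhds]
      simp
  simp_rw [hleibniz]
  rw [integral_sub hint' hint, integral_divergence_eq_zero hφF hφFc, zero_sub, neg_neg]

lemma divergence_eq_zero_of_forall_integral_eq_zero {Ω : Set X} (hΩ : IsOpen Ω) {F : X → X}
    (hF : ContDiffOn ℝ 1 F Ω)
    (h : ∀ φ : X → ℝ, ContDiff ℝ ∞ φ → HasCompactSupport φ → tsupport φ ⊆ Ω →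
      ∫ x, fderiv ℝ φ x (F x) ∂μ = 0) :
    ∀ x ∈ Ω, divergence F x = 0 := by
  have hcont := continuousOn_divergence hΩ hF
  have hae : ∀ᵐ x ∂μ, x ∈ Ω → divergence F x = 0 := by
    refine hΩ.ae_eq_zero_of_integral_contDiff_smul_eq_zero
      (hcont.locallyIntegrableOn hΩ.measurableSet) fun φ hφ hc hs => ?_
    simp only [smul_eq_mul]
    rw [integral_mul_divergence_eq_neg hΩ (hφ.of_le (by exact_mod_cast le_top)) hc hs hF,
      h φ hφ hc hs, neg_zero]
  exact Measure.eqOn_open_of_ae_eq ((ae_restrict_iff' hΩ.measurableSet).2 hae) hΩ hcont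
    continuousOn_const

end Divergence

/-! ### Conserved space-time currents -/

/-- A field on `[0, T] × E` is isolated in `A` if at all times it vanishes in a fixed collar
around `A`. -/
def IsIsolatedIn {E F : Type*} [TopologicalSpace E] [Zero F] (T : ℝ) (f : ℝ × E → F)
    (A : Set E) : Prop :=
  ∃ N, IsOpen N ∧ closure A ⊆ N ∧ ∀ t ∈ Icc 0 T, ∀ y ∈ N \ A, f (t, y) = 0

lemma IsIsolatedIn.eventuallyEq_indicator {E F : Type*} [TopologicalSpace E] [Zero F] {T : ℝ}
    {A : Set E} {f : ℝ × E → F} (h : IsIsolatedIn T f A) (z : ℝ × E) :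
    (univ ×ˢ A).indicator f =ᶠ[𝓝[Icc 0 T ×ˢ univ] z] f ∨
      (univ ×ˢ A).indicator f =ᶠ[𝓝[Icc 0 T ×ˢ univ] z] fun _ => 0 := by
  obtain ⟨N, hN, hAN, h0⟩ := h
  by_cases hz : z.2 ∈ N
  · left
    filter_upwards [self_mem_nhdsWithin, mem_nhdsWithin_of_mem_nhds
      (prod_mem_nhds univ_mem (hN.mem_nhds hz))] with x hx hxN
    by_cases hxA : x ∈ univ ×ˢ A
    · rw [indicator_of_mem hxA]
    · rw [indicator_of_notMem hxA, h0 x.1 hx.1 x.2 ⟨hxN.2, fun h => hxA ⟨mem_univ _, h⟩⟩]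
  · right
    filter_upwards [mem_nhdsWithin_of_mem_nhds (prod_mem_nhds univ_mem
      (isClosed_closure.isOpen_compl.mem_nhds fun h => hz (hAN h)))] with x hx
    exact indicator_of_notMem (fun h => hx.2 (subset_closure h.2)) _

lemma IsIsolatedIn.of_imp {E F G : Type*} [TopologicalSpace E] [Zero F] [Zero G] {T : ℝ}
    {A : Set E} {f : ℝ × E → F} {g : ℝ × E → G} (h : IsIsolatedIn T f A)
    (hg : ∀ z ∈ Icc 0 T ×ˢ univ, f z = 0 → g z = 0) : IsIsolatedIn T g A := by
  obtain ⟨N, hN, hAN, h0⟩ := h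
  exact ⟨N, hN, hAN, fun t ht y hy => hg _ ⟨ht, mem_univ y⟩ (h0 t ht y hy)⟩

lemma slab_mem_nhds {E : Type*} [TopologicalSpace E] {T : ℝ} {z : ℝ × E}
    (hz : z ∈ Ioo 0 T ×ˢ (univ : Set E)) : Icc 0 T ×ˢ (univ : Set E) ∈ 𝓝 z :=
  prod_mem_nhds (Icc_mem_nhds hz.1.1 hz.1.2) univ_mem

lemma continuous_slice {E F : Type*} [TopologicalSpace E] [TopologicalSpace F] {T : ℝ}
    {f : ℝ × E → F} (hf : ContinuousOn f (Icc 0 T ×ˢ univ)) {t : ℝ} (ht : t ∈ Icc 0 T) :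
    Continuous fun y => f (t, y) :=
  hf.comp_continuous (by fun_prop) fun y => ⟨ht, mem_univ y⟩

lemma integrableOn_of_isBounded {E F : Type*} [MetricSpace E] [ProperSpace E]
    [MeasurableSpace E] [OpensMeasurableSpace E] [NormedAddCommGroup F] {μ : Measure E}
    [IsFiniteMeasureOnCompacts μ] {f : E → F} {A : Set E} (hf : Continuous f)
    (hAb : Bornology.IsBounded A) : IntegrableOn f A μ :=
  (hf.continuousOn.integrableOn_compact hAb.isCompact_closure).mono_set subset_closure

lemma continuousOn_setIntegral_slab {E : Type*} [PseudoMetricSpace E] [ProperSpace E]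
    [MeasurableSpace E] [BorelSpace E] {μ : Measure E} [IsFiniteMeasureOnCompacts μ] {T : ℝ}
    {f : ℝ × E → ℝ} (hf : ContinuousOn f (Icc 0 T ×ˢ univ)) {A : Set E} (hA : MeasurableSet A)
    (hAb : Bornology.IsBounded A) : ContinuousOn (fun s => ∫ y in A, f (s, y) ∂μ) (Icc 0 T) := by
  obtain ⟨C, hC⟩ := (isCompact_Icc.prod hAb.isCompact_closure).exists_bound_of_continuousOn
    (hf.mono (prod_mono_right (subset_univ _)))
  refine continuousOn_of_dominated (bound := fun _ => C)
    (fun s hs => (continuous_slice hf hs).aestronglyMeasurable)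
    (fun s hs => ae_restrict_of_forall_mem hA fun y hy => hC (s, y) ⟨hs, subset_closure hy⟩)
    (integrableOn_const hAb.measure_lt_top.ne)
    (Eventually.of_forall fun y => hf.comp (by fun_prop) fun s hs => ⟨hs, mem_univ y⟩)

section Current

variable {E F : Type*} [NormedAddCommGroup E] [NormedSpace ℝ E] [NormedAddCommGroup F]
  [NormedSpace ℝ F] {T : ℝ}

lemma differentiableAt_of_contDiffOn_slab {f : ℝ × E → F}
    (hf : ContDiffOn ℝ 1 f (Icc 0 T ×ˢ univ)) {z : ℝ × E} (hz : z ∈ Ioo 0 T ×ˢ (univ : Set E)) :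
    DifferentiableAt ℝ f z :=
  (hf.contDiffAt (slab_mem_nhds hz)).differentiableAt one_ne_zero

/-- The passage `(t, y) ↦ (t, y + t w)` from coordinates moving with velocity `w` to coordinates
at rest. -/
def galilei (w : E) : (ℝ × E) ≃L[ℝ] (ℝ × E) :=
  .skewProd (.refl ℝ ℝ) (.refl ℝ E) (.toSpanSingleton ℝ w)

lemma galilei_apply (w : E) (z : ℝ × E) : galilei w z = (z.1, z.2 + z.1 • w) := rfl

lemma galilei_symm_apply (w : E) (z : ℝ × E) : (galilei w).symm z = (z.1, z.2 - z.1 • w) := rfl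

/-- A conserved current on `[0, T] × E`: a `C¹` space-time vector field, whose components are the
density and the flux of a conserved quantity, with vanishing space-time divergence. -/
structure IsConservedCurrent (T : ℝ) (V : ℝ × E → ℝ × E) : Prop where
  contDiffOn : ContDiffOn ℝ 1 V (Icc 0 T ×ˢ univ)
  divergence_eq_zero : ∀ z ∈ Ioo 0 T ×ˢ (univ : Set E), divergence V z = 0

namespace IsConservedCurrent

variable {V W : ℝ × E → ℝ × E}

lemma differentiableAt (hV : IsConservedCurrent T V) {z : ℝ × E}
    (hz : z ∈ Ioo 0 T ×ˢ (univ : Set E)) : DifferentiableAt ℝ V z :=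
  differentiableAt_of_contDiffOn_slab hV.contDiffOn hz

lemma sub (hV : IsConservedCurrent T V) (hW : IsConservedCurrent T W) :
    IsConservedCurrent T fun z => V z - W z where
  contDiffOn := hV.contDiffOn.sub hW.contDiffOn
  divergence_eq_zero z hz := by
    rw [divergence_sub (hV.differentiableAt hz) (hW.differentiableAt hz),
      hV.divergence_eq_zero z hz, hW.divergence_eq_zero z hz, sub_zero]

lemma const_smul (hV : IsConservedCurrent T V) (a : ℝ) :
    IsConservedCurrent T fun z => a • V z where
  contDiffOn := hV.contDiffOn.const_smul a
  divergence_eq_zero z hz := by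
    rw [divergence_const_smul a (hV.differentiableAt hz), hV.divergence_eq_zero z hz, mul_zero]

lemma comp_galilei (hV : IsConservedCurrent T V) (w : E) :
    IsConservedCurrent T fun z => (galilei w).symm (V (galilei w z)) where
  contDiffOn := (galilei w).symm.contDiff.comp_contDiffOn
    (hV.contDiffOn.comp (galilei w).contDiff.contDiffOn fun _ hz => ⟨hz.1, mem_univ _⟩)
  divergence_eq_zero z hz := by
    have hz' : galilei w z ∈ Ioo 0 T ×ˢ (univ : Set E) := ⟨hz.1, mem_univ _⟩
    rw [divergence_conj _ (hV.differentiableAt hz'), hV.divergence_eq_zero _ hz']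

lemma indicator (hV : IsConservedCurrent T V) {A : Set E} (hA : IsIsolatedIn T V A) :
    IsConservedCurrent T ((univ ×ˢ A).indicator V) where
  contDiffOn z hz := by
    rcases hA.eventuallyEq_indicator z with h | h
    · exact (hV.contDiffOn z hz).congr_of_eventuallyEq_of_mem h hz
    · exact contDiffWithinAt_const.congr_of_eventuallyEq_of_mem h hz
  divergence_eq_zero z hz := by
    have h := hA.eventuallyEq_indicator z
    rw [nhdsWithin_eq_nhds.2 (slab_mem_nhds hz)] at h
    rcases h with h | h
    · rw [divergence_congr h, hV.divergence_eq_zero z hz]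
    · rw [divergence_congr h, divergence_const]

end IsConservedCurrent

section Balance

variable [FiniteDimensional ℝ E]

lemma trace_prod (L : ℝ × E →ₗ[ℝ] ℝ × E) :
    LinearMap.trace ℝ (ℝ × E) L = (L (1, 0)).1
      + LinearMap.trace ℝ E (LinearMap.snd ℝ ℝ E ∘ₗ L ∘ₗ LinearMap.inr ℝ ℝ E) := by
  have hsplit : L = (LinearMap.fst ℝ ℝ E).smulRight (L (1, 0))
      + (L ∘ₗ LinearMap.inr ℝ ℝ E) ∘ₗ LinearMap.snd ℝ ℝ E := by
    ext <;> simp [Prod.mk_zero_zero]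
  conv_lhs => rw [hsplit, map_add, LinearMap.trace_smulRight, LinearMap.trace_comp_comm']
  rfl

lemma divergence_spacetime {V : ℝ × E → ℝ × E} {t : ℝ} {y : E}
    (hV : DifferentiableAt ℝ V (t, y)) :
    divergence V (t, y)
      = (fderiv ℝ V (t, y) (1, 0)).1 + divergence (fun x => (V (t, x)).2) y := by
  have hslice : HasFDerivAt (fun x => (V (t, x)).2) (ContinuousLinearMap.snd ℝ ℝ E ∘L
      fderiv ℝ V (t, y) ∘L ContinuousLinearMap.inr ℝ ℝ E) y :=
    hasFDerivAt_snd.comp y (hV.hasFDerivAt.comp y (hasFDerivAt_prodMk_right t y))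
  rw [divergence, trace_prod, divergence, hslice.fderiv]
  rfl

variable [MeasurableSpace E] [BorelSpace E] {μ : Measure E}

omit [FiniteDimensional ℝ E] in
lemma hasDerivAt_integral_of_compact_support [IsFiniteMeasureOnCompacts μ] {f : ℝ × E → ℝ}
    (hf : ContDiffOn ℝ 1 f (Icc 0 T ×ˢ univ)) {K : Set E} (hK : IsCompact K)
    (h0 : ∀ t ∈ Icc 0 T, ∀ y ∉ K, f (t, y) = 0) {t : ℝ} (ht : t ∈ Ioo 0 T) :
    Integrable (fun y => fderiv ℝ f (t, y) (1, 0)) μ ∧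
      HasDerivAt (fun s => ∫ y, f (s, y) ∂μ) (∫ y, fderiv ℝ f (t, y) (1, 0) ∂μ) t := by
  have hdf : ContinuousOn (fun z => fderiv ℝ f z (1, 0)) (Ioo 0 T ×ˢ univ) :=
    ((hf.mono (prod_mono_left Ioo_subset_Icc_self)).continuousOn_fderiv_of_isOpen
      (isOpen_Ioo.prod isOpen_univ) le_rfl).clm_apply continuousOn_const
  have hdf0 : ∀ s ∈ Ioo 0 T, ∀ y ∉ K, fderiv ℝ f (s, y) (1, 0) = 0 := by
    intro s hs y hy
    have : f =ᶠ[𝓝 (s, y)] fun _ => 0 := by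
      filter_upwards [prod_mem_nhds (Icc_mem_nhds hs.1 hs.2)
        (hK.isClosed.isOpen_compl.mem_nhds hy)] with z hz using h0 z.1 hz.1 z.2 hz.2
    rw [this.fderiv_eq, fderiv_const_apply]
    rfl
  have hint : ∀ s ∈ Icc 0 T, Integrable (fun y => f (s, y)) μ := fun s hs =>
    (continuous_slice hf.continuousOn hs).integrable_of_hasCompactSupport (.intro hK (h0 s hs))
  obtain ⟨t₁, t₂, -, hnhds, hsub⟩ := exists_Icc_mem_subset_of_mem_nhds (Ioo_mem_nhds ht.1 ht.2)
  obtain ⟨C, hC⟩ := (isCompact_Icc.prod hK).exists_bound_of_continuousOn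
    (hdf.mono (prod_mono hsub (subset_univ _)))
  refine hasDerivAt_integral_of_dominated_loc_of_deriv_le (s := Icc t₁ t₂)
    (F := fun s y => f (s, y)) (F' := fun s y => fderiv ℝ f (s, y) (1, 0))
    (bound := K.indicator fun _ => C) hnhds ?_ (hint t (Ioo_subset_Icc_self ht)) ?_ ?_ ?_ ?_
  · filter_upwards [Icc_mem_nhds ht.1 ht.2] with s hs using (hint s hs).aestronglyMeasurable
  · exact (hdf.comp_continuous (by fun_prop) fun y => ⟨ht, mem_univ y⟩).aestronglyMeasurable
  · refine Eventually.of_forall fun y s hs => ?_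
    by_cases hy : y ∈ K
    · rw [indicator_of_mem hy]
      exact hC (s, y) ⟨hs, hy⟩
    · rw [indicator_of_notMem hy, hdf0 s (hsub hs) y hy, norm_zero]
  · exact (integrable_indicator_iff hK.measurableSet).2 (integrableOn_const hK.measure_ne_top)
  · exact Eventually.of_forall fun y s hs =>
      ((differentiableAt_of_contDiffOn_slab hf ⟨hsub hs, mem_univ y⟩).hasFDerivAt.comp_hasDerivAt
        s ((hasDerivAt_id s).prodMk (hasDerivAt_const s y)))

variable [μ.IsAddHaarMeasure]

lemma hasDerivAt_integral_fst {V : ℝ × E → ℝ × E}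
    (hV : ContDiffOn ℝ 1 V (Icc 0 T ×ˢ univ)) {K : Set E} (hK : IsCompact K)
    (h0 : ∀ t ∈ Icc 0 T, ∀ y ∉ K, V (t, y) = 0) {t : ℝ} (ht : t ∈ Ioo 0 T) :
    HasDerivAt (fun s => ∫ y, (V (s, y)).1 ∂μ) (∫ y, divergence V (t, y) ∂μ) t := by
  have hdiff : ∀ y, DifferentiableAt ℝ V (t, y) := fun y =>
    differentiableAt_of_contDiffOn_slab hV ⟨ht, mem_univ y⟩
  have hflux : ContDiff ℝ 1 fun y => (V (t, y)).2 :=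
    (contDiff_snd.comp_contDiffOn hV).comp_contDiff (contDiff_prodMk_right t)
      fun y => ⟨Ioo_subset_Icc_self ht, mem_univ y⟩
  have hflux_c : HasCompactSupport fun y => (V (t, y)).2 :=
    .intro hK fun y hy => by rw [h0 t (Ioo_subset_Icc_self ht) y hy, Prod.snd_zero]
  have hdiv_int : Integrable (divergence fun y => (V (t, y)).2) μ :=
    (traceL E).integrable_comp
      ((hflux.continuous_fderiv one_ne_zero).integrable_of_hasCompactSupport (hflux_c.fderiv ℝ))
  obtain ⟨hdt_int, hderiv⟩ := hasDerivAt_integral_of_compact_support (μ := μ)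
    (contDiff_fst.comp_contDiffOn hV) hK (fun s hs y hy => congrArg Prod.fst (h0 s hs y hy)) ht
  have hdiv : ∀ y, divergence V (t, y)
      = fderiv ℝ (Prod.fst ∘ V) (t, y) (1, 0) + divergence (fun x => (V (t, x)).2) y := by
    intro y
    rw [divergence_spacetime (hdiff y), (hasFDerivAt_fst.comp _ (hdiff y).hasFDerivAt).fderiv]
    rfl
  refine hderiv.congr_deriv ?_
  simp_rw [hdiv]
  rw [integral_add hdt_int hdiv_int, integral_divergence_eq_zero hflux hflux_c, add_zero]

namespace IsConservedCurrent

variable {V : ℝ × E → ℝ × E} {A : Set E}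

lemma hasDerivAt_setIntegral_mul_fst (hV : IsConservedCurrent T V) (hVA : IsIsolatedIn T V A)
    (hA : MeasurableSet A) (hAb : Bornology.IsBounded A) {q : E → ℝ} (hq : ContDiff ℝ 1 q) {t : ℝ}
    (ht : t ∈ Ioo 0 T) :
    HasDerivAt (fun s => ∫ y in A, q y * (V (s, y)).1 ∂μ)
      (∫ y in A, fderiv ℝ q y (V (t, y)).2 ∂μ) t := by
  have hW := hV.indicator hVA
  set W := (univ ×ˢ A).indicator V
  have hWA : ∀ s, ∀ y ∈ A, W (s, y) = V (s, y) := fun s y hy =>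
    indicator_of_mem (show (s, y) ∈ univ ×ˢ A from ⟨mem_univ s, hy⟩) V
  have hW0 : ∀ s, ∀ y ∉ A, W (s, y) = 0 := fun s y hy => indicator_of_notMem (fun h => hy h.2) V
  have hqW_div : ∀ y, divergence (fun z => q z.2 • W z) (t, y) = fderiv ℝ q y (W (t, y)).2 := by
    intro y
    have hq' : HasFDerivAt (fun z : ℝ × E => q z.2) _ (t, y) :=
      (hq.differentiable one_ne_zero y).hasFDerivAt.comp (t, y) hasFDerivAt_snd
    rw [divergence_smul hq'.differentiableAt (hW.differentiableAt ⟨ht, mem_univ y⟩),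
      hW.divergence_eq_zero (t, y) ⟨ht, mem_univ y⟩, hq'.fderiv, mul_zero, zero_add]
    rfl
  have hderiv := hasDerivAt_integral_fst (μ := μ) (V := fun z => q z.2 • W z)
    ((hq.comp contDiff_snd).contDiffOn.smul hW.contDiffOn) hAb.isCompact_closure
    (fun s _ y hy => by rw [hW0 s y fun h => hy (subset_closure h), smul_zero]) ht
  simp_rw [hqW_div] at hderiv
  refine (hderiv.congr_deriv ?_).congr_of_eventuallyEq (Eventually.of_forall fun s => ?_)
  · rw [← setIntegral_eq_integral_of_forall_compl_eq_zero fun y hy => by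
      rw [hW0 t y hy, Prod.snd_zero, map_zero]]
    exact setIntegral_congr_fun hA fun y hy => by rw [hWA t y hy]
  · change _ = ∫ y, (q y • W (s, y)).1 ∂μ
    rw [← setIntegral_eq_integral_of_forall_compl_eq_zero fun y hy => by
      rw [hW0 s y hy, smul_zero, Prod.fst_zero]]
    exact setIntegral_congr_fun hA fun y hy => by rw [hWA s y hy]; rfl

lemma setIntegral_fst_eq (hV : IsConservedCurrent T V) (hVA : IsIsolatedIn T V A)
    (hA : MeasurableSet A) (hAb : Bornology.IsBounded A) {t : ℝ} (ht : t ∈ Icc 0 T) :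
    ∫ y in A, (V (t, y)).1 ∂μ = ∫ y in A, (V (0, y)).1 ∂μ := by
  refine eq_of_hasDerivAt_zero (f := fun s => ∫ y in A, (V (s, y)).1 ∂μ)
    (continuousOn_setIntegral_slab hV.contDiffOn.continuousOn.fst hA hAb) (fun s hs => ?_)
    ⟨le_rfl, ht.1.trans ht.2⟩ ht
  simpa using hV.hasDerivAt_setIntegral_mul_fst (μ := μ) hVA hA hAb
    (contDiff_const (c := (1 : ℝ))) hs

end IsConservedCurrent

end Balance

end Current

section Virial

open RealInnerProductSpace

variable {T t : ℝ}

lemma IsConservedCurrent.hasDerivAt_setIntegral_norm_sq_mul_fst {E : Type*}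
    [NormedAddCommGroup E] [InnerProductSpace ℝ E] [FiniteDimensional ℝ E] [MeasurableSpace E]
    [BorelSpace E] {μ : Measure E} [μ.IsAddHaarMeasure] {V : ℝ × E → ℝ × E} {A : Set E}
    (hV : IsConservedCurrent T V) (hVA : IsIsolatedIn T V A) (hA : MeasurableSet A)
    (hAb : Bornology.IsBounded A) (ht : t ∈ Ioo 0 T) :
    HasDerivAt (fun s => ∫ y in A, ‖y‖ ^ 2 * (V (s, y)).1 ∂μ)
      (2 * ∫ y in A, ⟪y, (V (t, y)).2⟫ ∂μ) t := by
  refine (hV.hasDerivAt_setIntegral_mul_fst (μ := μ) hVA hA hAb (contDiff_norm_sq ℝ)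
    ht).congr_deriv ?_
  rw [← integral_const_mul]
  refine setIntegral_congr_fun hA fun y _ => ?_
  simp [fderiv_norm_sq_apply]

lemma hasDerivAt_setIntegral_inner_snd {ι : Type*} [Fintype ι] {A : Set (EuclideanSpace ℝ ι)}
    {V : ℝ × EuclideanSpace ℝ ι → ℝ × EuclideanSpace ℝ ι}
    {J : ι → ℝ × EuclideanSpace ℝ ι → ℝ × EuclideanSpace ℝ ι}
    (hJ : ∀ i, IsConservedCurrent T (J i)) (hJA : ∀ i, IsIsolatedIn T (J i) A)
    (hJV : ∀ i z, (J i z).1 = (V z).2 i) (hA : MeasurableSet A) (hAb : Bornology.IsBounded A)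
    (ht : t ∈ Ioo 0 T) :
    HasDerivAt (fun s => ∫ y in A, ⟪y, (V (s, y)).2⟫) (∫ y in A, ∑ i, (J i (t, y)).2 i) t := by
  have hcoord : ∀ i, ContDiff ℝ 1 fun y : EuclideanSpace ℝ ι => y i := fun i =>
    contDiff_piLp_apply 2
  have hslice : ∀ i, ∀ s ∈ Icc 0 T, Continuous fun y => J i (s, y) := fun i s hs =>
    continuous_slice (hJ i).contDiffOn.continuousOn hs
  have hsum : ∀ s ∈ Icc 0 T, ∫ y in A, ⟪y, (V (s, y)).2⟫
      = ∑ i, ∫ y in A, y i * (J i (s, y)).1 := by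
    intro s hs
    have hmoment : ∀ i, IntegrableOn (fun y => y i * (J i (s, y)).1) A := fun i =>
      integrableOn_of_isBounded ((hcoord i).continuous.mul (hslice i s hs).fst) hAb
    rw [← integral_finsetSum _ fun i _ => hmoment i]
    simp only [PiLp.inner_apply, hJV, RCLike.inner_apply, conj_trivial, mul_comm]
  have hderiv := HasDerivAt.fun_sum (u := Finset.univ) fun i _ =>
    (hJ i).hasDerivAt_setIntegral_mul_fst (μ := volume) (hJA i) hA hAb (hcoord i) ht
  refine (hderiv.congr_deriv ?_).congr_of_eventuallyEq ?_
  · have hflux : ∀ i, IntegrableOn (fun y => (J i (t, y)).2 i) A := fun i =>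
      integrableOn_of_isBounded
        ((hcoord i).continuous.comp (hslice i t (Ioo_subset_Icc_self ht)).snd) hAb
    rw [integral_finsetSum _ fun i _ => hflux i]
    refine Finset.sum_congr rfl fun i _ => setIntegral_congr_fun hA fun y _ => ?_
    exact DFunLike.congr_fun (ContinuousLinearMap.fderiv (𝕜 := ℝ) (x := y)
      (EuclideanSpace.proj (𝕜 := ℝ) i : EuclideanSpace ℝ ι →L[ℝ] ℝ)) (J i (t, y)).2
  · filter_upwards [Icc_mem_nhds ht.1 ht.2] with s hs using hsum s hs

lemma mul_setIntegral_sub_le {α : Type*} [MeasurableSpace α] {μ : Measure α} {A : Set α}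
    {f g : α → ℝ} {ν l : ℝ} (hA : μ A ≠ ⊤) (hf : IntegrableOn f A μ) (hg : IntegrableOn g A μ)
    (hfg : ∀ y, ν * (f y - l) ≤ g y) :
    ν * ((∫ y in A, f y ∂μ) - l * μ.real A) ≤ ∫ y in A, g y ∂μ := by
  have hconst : IntegrableOn (fun _ => l) A μ := integrableOn_const hA
  calc ν * ((∫ y in A, f y ∂μ) - l * μ.real A) = ∫ y in A, ν * (f y - l) ∂μ := by
        rw [integral_const_mul, integral_sub hf hconst, setIntegral_const, smul_eq_mul, mul_comm l]
    _ ≤ ∫ y in A, g y ∂μ := setIntegral_mono ((hf.sub hconst).const_mul ν) hg hfg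

/-- The virial argument: the second moment of the density stays between `0` and `R ^ 2` times the
conserved total, while its second derivative is twice the integrated trace of the fluxes. -/
lemma mul_sq_le_of_virial {ι : Type*} [Fintype ι] {A : Set (EuclideanSpace ℝ ι)}
    {V : ℝ × EuclideanSpace ℝ ι → ℝ × EuclideanSpace ℝ ι}
    {J : ι → ℝ × EuclideanSpace ℝ ι → ℝ × EuclideanSpace ℝ ι} {R ν l : ℝ}
    (hV : IsConservedCurrent T V) (hVA : IsIsolatedIn T V A)
    (hJ : ∀ i, IsConservedCurrent T (J i)) (hJA : ∀ i, IsIsolatedIn T (J i) A)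
    (hJV : ∀ i z, (J i z).1 = (V z).2 i) (hA : MeasurableSet A)
    (hAR : A ⊆ Metric.closedBall 0 R) (hT : 0 ≤ T)
    (hV0 : ∀ z ∈ Icc 0 T ×ˢ univ, 0 ≤ (V z).1)
    (hVJ : ∀ z ∈ Icc 0 T ×ˢ univ, ν * ((V z).1 - l) ≤ ∑ i, (J i z).2 i) :
    ν * ((∫ y in A, (V (0, y)).1) - l * volume.real A) * T ^ 2
      ≤ 4 * (R ^ 2 * ∫ y in A, (V (0, y)).1) := by
  have hAb : Bornology.IsBounded A := Metric.isBounded_closedBall.subset hAR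
  have hVc := hV.contDiffOn.continuousOn
  have hslice : ∀ t ∈ Icc 0 T, Continuous fun y => (V (t, y)).1 := fun t ht =>
    (continuous_slice hVc ht).fst
  have hflux : ∀ t ∈ Icc 0 T, ν * ((∫ y in A, (V (0, y)).1) - l * volume.real A)
      ≤ ∫ y in A, ∑ i, (J i (t, y)).2 i := fun t ht => by
    have hJc : Continuous fun y => ∑ i, (J i (t, y)).2 i := continuous_finsetSum _ fun i _ =>
      (EuclideanSpace.proj (𝕜 := ℝ) i).continuous.comp
        (continuous_slice (hJ i).contDiffOn.continuousOn ht).snd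
    rw [← hV.setIntegral_fst_eq hVA hA hAb ht]
    exact mul_setIntegral_sub_le hAb.measure_lt_top.ne (integrableOn_of_isBounded (hslice t ht) hAb)
      (integrableOn_of_isBounded hJc hAb) fun y => hVJ (t, y) ⟨ht, mem_univ y⟩
  have hmoment := mul_sq_le_of_le_deriv_deriv hT
    (continuousOn_setIntegral_slab (μ := volume) (f := fun z => ‖z.2‖ ^ 2 * (V z).1)
      ((continuous_snd.norm.pow 2).continuousOn.mul hVc.fst) hA hAb)
    (fun t ht => hV.hasDerivAt_setIntegral_norm_sq_mul_fst (μ := volume) hVA hA hAb ht)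
    (fun t ht => (hasDerivAt_setIntegral_inner_snd hJ hJA hJV hA hAb ht).const_mul 2)
    (fun t ht => mul_le_mul_of_nonneg_left (hflux t (Ioo_subset_Icc_self ht)) zero_le_two)
    (B := R ^ 2 * ∫ y in A, (V (0, y)).1)
    (fun t ht => setIntegral_nonneg hA fun y _ =>
      mul_nonneg (by positivity) (hV0 (t, y) ⟨ht, mem_univ y⟩)) (fun t ht => ?_)
  · linarith
  · rw [← hV.setIntegral_fst_eq hVA hA hAb ht, ← integral_const_mul]
    refine setIntegral_mono_on (integrableOn_of_isBounded
      ((continuous_norm.pow 2).mul (hslice t ht)) hAb)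
      (integrableOn_of_isBounded (continuous_const.mul (hslice t ht)) hAb) hA fun y hy => ?_
    have hyR := mem_closedBall_zero_iff.1 (hAR hy)
    have hVy := hV0 (t, y) ⟨ht, mem_univ y⟩
    gcongr

end Virial

/-! ### Transport of the density along the flow -/

section Transport

open RealInnerProductSpace

lemma divergence_smul_velocity_eq {E : Type*} [NormedAddCommGroup E] [NormedSpace ℝ E]
    [FiniteDimensional ℝ E] {κ : ℝ} {m P : ℝ × E → ℝ} {u : ℝ × E → E} {z : ℝ × E}
    (hm : DifferentiableAt ℝ m z) (hP : DifferentiableAt ℝ P z) (hu : DifferentiableAt ℝ u z)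
    (henergy : divergence (fun y => m y • (1, u y) - (κ * P y) • (1, 0)) z = 0) :
    divergence (fun y => m y • (1, u y)) z = κ * fderiv ℝ P z (1, 0) := by
  rw [divergence_sub (hm.fun_smul ((differentiableAt_const 1).prodMk hu))
    ((hP.const_mul κ).smul_const _), divergence_smul_const (hP.const_mul κ), sub_eq_zero] at henergy
  rw [henergy, fderiv_const_mul hP]
  rfl

variable {ι : Type*} [Fintype ι] [DecidableEq ι] {κ : ℝ}
  {m P r : ℝ × EuclideanSpace ℝ ι → ℝ} {u : ℝ × EuclideanSpace ℝ ι → EuclideanSpace ℝ ι}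
  {z : ℝ × EuclideanSpace ℝ ι}

lemma mul_inner_fderiv_velocity_eq (hm : DifferentiableAt ℝ m z) (hP : DifferentiableAt ℝ P z)
    (hu : DifferentiableAt ℝ u z)
    (henergy : divergence (fun y => m y • (1, u y) - (κ * P y) • (1, 0)) z = 0)
    (hmomentum : ∀ i, divergence
      (fun y => (m y * u y i) • (1, u y) + P y • (0, EuclideanSpace.single i 1)) z = 0) :
    m z * ⟪u z, fderiv ℝ u z (1, u z)⟫
      = -fderiv ℝ P z (0, u z) - κ * ‖u z‖ ^ 2 * fderiv ℝ P z (1, 0) := by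
  have hmW : DifferentiableAt ℝ (fun y => m y • ((1 : ℝ), u y)) z :=
    hm.fun_smul ((differentiableAt_const 1).prodMk hu)
  have hui : ∀ i, HasFDerivAt (fun y => u y i)
      ((EuclideanSpace.proj i : EuclideanSpace ℝ ι →L[ℝ] ℝ) ∘L fderiv ℝ u z) z := fun i =>
    (EuclideanSpace.proj i : EuclideanSpace ℝ ι →L[ℝ] ℝ).hasFDerivAt.comp z hu.hasFDerivAt
  have hcomponent : ∀ i, m z * fderiv ℝ u z (1, u z) i
      = -fderiv ℝ P z (0, EuclideanSpace.single i 1) - κ * u z i * fderiv ℝ P z (1, 0) := by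
    intro i
    have h := hmomentum i
    simp only [mul_comm (m _), mul_smul] at h
    rw [divergence_add ((hui i).differentiableAt.fun_smul hmW) (hP.smul_const _),
      divergence_smul (hui i).differentiableAt hmW, divergence_smul_const hP,
      divergence_smul_velocity_eq hm hP hu henergy, (hui i).fderiv, map_smul] at h
    simp only [ContinuousLinearMap.comp_apply, smul_eq_mul, PiLp.proj_apply] at h
    linarith
  have hPu : fderiv ℝ P z (0, u z)
      = ∑ i, u z i * fderiv ℝ P z (0, EuclideanSpace.single i 1) := by
    have hsum := (EuclideanSpace.basisFun ι ℝ).sum_repr (u z)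
    simp only [EuclideanSpace.basisFun_repr, EuclideanSpace.basisFun_apply] at hsum
    change (fderiv ℝ P z ∘L ContinuousLinearMap.inr ℝ ℝ _) (u z) = _
    conv_lhs => rw [← hsum, map_sum]
    simp only [map_smul, smul_eq_mul, ContinuousLinearMap.comp_apply,
      ContinuousLinearMap.inr_apply]
  simp only [hPu, PiLp.inner_apply, RCLike.inner_apply, conj_trivial,
    EuclideanSpace.real_norm_sq_eq, Finset.mul_sum, Finset.sum_mul, ← Finset.sum_neg_distrib,
    ← Finset.sum_sub_distrib]
  exact Finset.sum_congr rfl fun i _ => by linear_combination u z i * hcomponent i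

/-- The pressure drops out because the time derivatives of `P` in the energy and momentum
balances cancel; what remains is proportional to `m`. -/
lemma fderiv_apply_velocity_of_balance (hm : DifferentiableAt ℝ m z) (hP : DifferentiableAt ℝ P z)
    (hr : DifferentiableAt ℝ r z) (hu : DifferentiableAt ℝ u z)
    (henergy : divergence (fun y => m y • (1, u y) - (κ * P y) • (1, 0)) z = 0)
    (hmomentum : ∀ i, divergence
      (fun y => (m y * u y i) • (1, u y) + P y • (0, EuclideanSpace.single i 1)) z = 0)
    (hmr : (fun y => m y * (1 - κ * ‖u y‖ ^ 2)) =ᶠ[𝓝 z] fun y => r y + κ * P y) :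
    fderiv ℝ r z (1, u z) = -(m z * ((1 - κ * ‖u z‖ ^ 2) * divergence (fun y => ((1 : ℝ), u y)) z
      + κ * ⟪u z, fderiv ℝ u z (1, u z)⟫)) := by
  have hmdiv := divergence_smul_velocity_eq hm hP hu henergy
  rw [divergence_smul hm ((differentiableAt_const 1).prodMk hu)] at hmdiv
  have hmu := mul_inner_fderiv_velocity_eq hm hP hu henergy hmomentum
  have hmr' := congrArg (fun L : _ →L[ℝ] ℝ => L (1, u z)) (hmr.fderiv_eq (𝕜 := ℝ))
  have hfactor : HasFDerivAt (fun y => 1 - κ * ‖u y‖ ^ 2) _ z :=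
    (hu.hasFDerivAt.norm_sq.const_mul κ).const_sub 1
  rw [(hm.hasFDerivAt.fun_mul hfactor).fderiv,
    (hr.hasFDerivAt.fun_add (hP.hasFDerivAt.const_mul κ)).fderiv] at hmr'
  have hPW : fderiv ℝ P z (1, u z) = fderiv ℝ P z (1, 0) + fderiv ℝ P z (0, u z) := by
    rw [← map_add, Prod.mk_add_mk, add_zero, zero_add]
  simp only [smul_neg, add_apply, neg_apply, smul_apply, ContinuousLinearMap.comp_apply,
    coe_innerSL_apply, nsmul_eq_mul, Nat.cast_ofNat, smul_eq_mul] at hmr'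
  rw [hPW] at hmr'
  linear_combination -hmr' + (1 - κ * ‖u z‖ ^ 2) * hmdiv - κ * hmu

end Transport

/-! ### The currents of a regular solution -/

section Constitutive

variable {c k γ r : ℝ} {v : E3}

lemma contDiff_pressure (hγ : 1 ≤ γ) : ContDiff ℝ 1 (pressure k γ) :=
  contDiff_const.mul (Real.contDiff_rpow_const_of_le (n := 1) (by simpa using hγ))

lemma pressure_zero (hγ : 1 ≤ γ) : pressure k γ 0 = 0 := by
  rw [pressure, Real.zero_rpow (by linarith), mul_zero]

lemma pressure_nonneg (hr : 0 ≤ r) : 0 ≤ pressure k γ r := by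
  unfold pressure
  positivity

lemma pressure_eq_mul (hγ : 1 ≤ γ) (hr : 0 ≤ r) :
    pressure k γ r = r * (k ^ 2 * r ^ (γ - 1)) := by
  rw [pressure, mul_left_comm, mul_comm r, ← Real.rpow_add_one' hr (by linarith), sub_add_cancel]

lemma one_sub_norm_sq_div_pos (hv : ‖v‖ < c) : 0 < 1 - ‖v‖ ^ 2 / c ^ 2 := by
  have hc : 0 < c := (norm_nonneg v).trans_lt hv
  rw [sub_pos, div_lt_one (by positivity)]
  exact pow_lt_pow_left₀ hv (norm_nonneg v) two_ne_zero

lemma rhoTilde_zero (hγ : 1 ≤ γ) : rhoTilde c k γ 0 v = 0 := by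
  simp [rhoTilde, pressure_zero hγ]

lemma rhoTilde_mul (hv : ‖v‖ < c) :
    rhoTilde c k γ r v * (1 - ‖v‖ ^ 2 / c ^ 2) = r + pressure k γ r / c ^ 2 :=
  div_mul_cancel₀ _ (one_sub_norm_sq_div_pos hv).ne'

lemma rhoTilde_nonneg (hv : ‖v‖ < c) (hr : 0 ≤ r) : 0 ≤ rhoTilde c k γ r v :=
  div_nonneg (add_nonneg hr (div_nonneg (pressure_nonneg hr) (by positivity)))
    (one_sub_norm_sq_div_pos hv).le

lemma rhoHat_eq_rhoTilde_sub (hv : ‖v‖ < c) :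
    rhoHat c k γ r v = rhoTilde c k γ r v - pressure k γ r / c ^ 2 := by
  have hc : c ≠ 0 := ((norm_nonneg v).trans_lt hv).ne'
  have h := (one_sub_norm_sq_div_pos hv).ne'
  rw [rhoHat, rhoTilde, eq_sub_iff_add_eq, div_add' _ _ _ h]
  congr 1
  field_simp
  ring

lemma rhoHat_eq_add (hv : ‖v‖ < c) :
    rhoHat c k γ r v = r + rhoTilde c k γ r v * ‖v‖ ^ 2 / c ^ 2 := by
  rw [rhoHat_eq_rhoTilde_sub hv]
  linear_combination rhoTilde_mul (k := k) (γ := γ) (r := r) hv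

lemma le_rhoHat (hv : ‖v‖ < c) (hr : 0 ≤ r) : r ≤ rhoHat c k γ r v := by
  rw [rhoHat_eq_add hv]
  exact le_add_of_nonneg_right
    (div_nonneg (mul_nonneg (rhoTilde_nonneg hv hr) (by positivity)) (by positivity))

lemma rhoHat_nonneg (hv : ‖v‖ < c) (hr : 0 ≤ r) : 0 ≤ rhoHat c k γ r v := hr.trans (le_rhoHat hv hr)

end Constitutive

section Solution

variable {c k γ T : ℝ} {ρ₀ : E3 → ℝ} {u₀ : E3 → E3} {ρ : ℝ → E3 → ℝ} {u : ℝ → E3 → E3}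

/-- The space-time current `(ρ̂, ρ̃ u)` of the energy equation. -/
def energyCurrent (c k γ : ℝ) (ρ : ℝ → E3 → ℝ) (u : ℝ → E3 → E3) (z : ℝ × E3) : ℝ × E3 :=
  (rhoHat c k γ (ρ z.1 z.2) (u z.1 z.2), rhoTilde c k γ (ρ z.1 z.2) (u z.1 z.2) • u z.1 z.2)

/-- The space-time current `(ρ̃ uᵢ, ρ̃ uᵢ u + P eᵢ)` of the `i`-th momentum equation. -/
def momentumCurrent (c k γ : ℝ) (ρ : ℝ → E3 → ℝ) (u : ℝ → E3 → E3) (i : Fin 3)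
    (z : ℝ × E3) : ℝ × E3 :=
  (rhoTilde c k γ (ρ z.1 z.2) (u z.1 z.2) * u z.1 z.2 i) • (1, u z.1 z.2)
    + pressure k γ (ρ z.1 z.2) • (0, EuclideanSpace.single i 1)

lemma energyCurrent_eq {z : ℝ × E3} (hz : ‖u z.1 z.2‖ < c) :
    energyCurrent c k γ ρ u z = rhoTilde c k γ (ρ z.1 z.2) (u z.1 z.2) • (1, u z.1 z.2)
      - (1 / c ^ 2 * pressure k γ (ρ z.1 z.2)) • (1, 0) := by
  rw [energyCurrent, rhoHat_eq_rhoTilde_sub hz]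
  ext <;> simp [div_eq_inv_mul]

lemma fderiv_apply_eq_dt_add_dx (φ : ℝ × E3 → ℝ) (z : ℝ × E3) (a : ℝ) (v : E3) :
    fderiv ℝ φ z (a, v) = a * dt φ z + dx φ z v := by
  rw [dt, dx, ← smul_eq_mul, ← map_smul, ← map_add]
  simp

instance : (volume : Measure (ℝ × E3)).IsAddHaarMeasure :=
  inferInstanceAs ((volume : Measure ℝ).prod (volume : Measure E3)).IsAddHaarMeasure

namespace IsRegularSolution

lemma contDiffOn_pressure (h : IsRegularSolution c k γ ρ₀ u₀ T ρ u) (hγ : 1 ≤ γ) :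
    ContDiffOn ℝ 1 (fun z : ℝ × E3 => pressure k γ (ρ z.1 z.2)) (Icc 0 T ×ˢ univ) :=
  (contDiff_pressure hγ).comp_contDiffOn h.density_c1

lemma contDiffOn_rhoTilde (h : IsRegularSolution c k γ ρ₀ u₀ T ρ u) (hγ : 1 ≤ γ) :
    ContDiffOn ℝ 1 (fun z : ℝ × E3 => rhoTilde c k γ (ρ z.1 z.2) (u z.1 z.2))
      (Icc 0 T ×ˢ univ) :=
  (h.density_c1.add ((h.contDiffOn_pressure hγ).div_const _)).div
    (contDiffOn_const.sub ((h.velocity_c1.norm_sq ℝ).div_const _)) fun z hz =>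
      (one_sub_norm_sq_div_pos (h.subluminal z.1 hz.1 z.2)).ne'

lemma isConservedCurrent_energyCurrent (h : IsRegularSolution c k γ ρ₀ u₀ T ρ u) (hγ : 1 ≤ γ) :
    IsConservedCurrent T (energyCurrent c k γ ρ u) := by
  have hsmooth : ContDiffOn ℝ 1 (energyCurrent c k γ ρ u) (Icc 0 T ×ˢ univ) :=
    (((h.contDiffOn_rhoTilde hγ).smul (contDiffOn_const.prodMk h.velocity_c1)).sub
      ((contDiffOn_const.mul (h.contDiffOn_pressure hγ)).smul contDiffOn_const)).congr
      fun z hz => energyCurrent_eq (h.subluminal z.1 hz.1 z.2)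
  refine ⟨hsmooth, divergence_eq_zero_of_forall_integral_eq_zero (μ := volume)
    (isOpen_Ioo.prod isOpen_univ) (hsmooth.mono (prod_mono_left Ioo_subset_Icc_self))
    fun φ hφ hc hs => ?_⟩
  rw [← h.weak_energy φ ⟨hφ, hc, hs⟩]
  refine integral_congr_ae (.of_forall fun z => ?_)
  change fderiv ℝ φ z (energyCurrent c k γ ρ u z) = _
  rw [energyCurrent, fderiv_apply_eq_dt_add_dx, dx, ← Prod.smul_zero_mk, map_smul]
  rfl

lemma isConservedCurrent_momentumCurrent (h : IsRegularSolution c k γ ρ₀ u₀ T ρ u) (hγ : 1 ≤ γ)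
    (i : Fin 3) : IsConservedCurrent T (momentumCurrent c k γ ρ u i) := by
  have hsmooth : ContDiffOn ℝ 1 (momentumCurrent c k γ ρ u i) (Icc 0 T ×ˢ univ) :=
    (((h.contDiffOn_rhoTilde hγ).mul (contDiffOn_euclidean.1 h.velocity_c1 i)).smul
      (contDiffOn_const.prodMk h.velocity_c1)).add
      ((h.contDiffOn_pressure hγ).smul contDiffOn_const)
  refine ⟨hsmooth, divergence_eq_zero_of_forall_integral_eq_zero (μ := volume)
    (isOpen_Ioo.prod isOpen_univ) (hsmooth.mono (prod_mono_left Ioo_subset_Icc_self))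
    fun φ hφ hc hs => ?_⟩
  rw [← h.weak_momentum φ ⟨hφ, hc, hs⟩ i]
  refine integral_congr_ae (.of_forall fun z => ?_)
  simp only [momentumCurrent, map_add, map_smul, fderiv_apply_eq_dt_add_dx, smul_eq_mul]
  ring

open RealInnerProductSpace in
lemma fderiv_density_apply (h : IsRegularSolution c k γ ρ₀ u₀ T ρ u) (hγ : 1 ≤ γ) {z : ℝ × E3}
    (hz : z ∈ Ioo 0 T ×ˢ (univ : Set E3)) :
    fderiv ℝ (fun z : ℝ × E3 => ρ z.1 z.2) z (1, u z.1 z.2)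
      = -(rhoTilde c k γ (ρ z.1 z.2) (u z.1 z.2) * ((1 - 1 / c ^ 2 * ‖u z.1 z.2‖ ^ 2)
          * divergence (fun z : ℝ × E3 => ((1 : ℝ), u z.1 z.2)) z
        + 1 / c ^ 2 * ⟪u z.1 z.2,
          fderiv ℝ (fun z : ℝ × E3 => u z.1 z.2) z (1, u z.1 z.2)⟫)) := by
  have hslab := slab_mem_nhds hz
  refine fderiv_apply_velocity_of_balance (u := fun z : ℝ × E3 => u z.1 z.2)
    (differentiableAt_of_contDiffOn_slab (h.contDiffOn_rhoTilde hγ) hz)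
    (differentiableAt_of_contDiffOn_slab (h.contDiffOn_pressure hγ) hz)
    (differentiableAt_of_contDiffOn_slab h.density_c1 hz)
    (differentiableAt_of_contDiffOn_slab h.velocity_c1 hz) ?_
    (fun i => (h.isConservedCurrent_momentumCurrent hγ i).divergence_eq_zero z hz) ?_
  · rw [← (h.isConservedCurrent_energyCurrent hγ).divergence_eq_zero z hz]
    refine divergence_congr ?_
    filter_upwards [hslab] with y hy using (energyCurrent_eq (h.subluminal y.1 hy.1 y.2)).symm
  · filter_upwards [hslab] with y hy
    simpa only [div_eq_inv_mul, mul_one]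
      using rhoTilde_mul (k := k) (γ := γ) (h.subluminal y.1 hy.1 y.2)

lemma exists_fderiv_density_apply_eq_mul (h : IsRegularSolution c k γ ρ₀ u₀ T ρ u)
    (hγ : 1 ≤ γ) :
    ∃ g : ℝ × E3 → ℝ, ContinuousOn g (Icc 0 T ×ˢ univ) ∧ ∀ z ∈ Ioo 0 T ×ˢ (univ : Set E3),
      fderiv ℝ (fun z : ℝ × E3 => ρ z.1 z.2) z (1, u z.1 z.2) = g z * ρ z.1 z.2 := by
  set S : Set (ℝ × E3) := Icc 0 T ×ˢ univ
  set W : ℝ × E3 → ℝ × E3 := fun z => (1, u z.1 z.2)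
  have hS : UniqueDiffOn ℝ S := (uniqueDiffOn_Icc h.pos_time).prod uniqueDiffOn_univ
  have hu := h.velocity_c1
  have hW : ContDiffOn ℝ 1 W S := contDiffOn_const.prodMk hu
  have hratio : ContinuousOn (fun z : ℝ × E3 => (1 + k ^ 2 * ρ z.1 z.2 ^ (γ - 1) / c ^ 2) /
      (1 - ‖u z.1 z.2‖ ^ 2 / c ^ 2)) S :=
    .div (continuousOn_const.add ((continuousOn_const.mul
        (h.density_c1.continuousOn.rpow_const fun _ _ => .inr (by linarith))).div_const _))
      (continuousOn_const.sub ((hu.continuousOn.norm.pow 2).div_const _))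
      fun z hz => (one_sub_norm_sq_div_pos (h.subluminal z.1 hz.1 z.2)).ne'
  refine ⟨fun z => -((1 + k ^ 2 * ρ z.1 z.2 ^ (γ - 1) / c ^ 2) / (1 - ‖u z.1 z.2‖ ^ 2 / c ^ 2)
    * ((1 - 1 / c ^ 2 * ‖u z.1 z.2‖ ^ 2) * traceL (ℝ × E3) (fderivWithin ℝ W S z)
      + 1 / c ^ 2 * inner ℝ (u z.1 z.2)
        (fderivWithin ℝ (fun z : ℝ × E3 => u z.1 z.2) S z (W z)))), ?_, fun z hz => ?_⟩
  · refine (hratio.mul (.add (.mul ?_ ?_) (continuousOn_const.mul ?_))).neg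
    · exact continuousOn_const.sub (continuousOn_const.mul (hu.continuousOn.norm.pow 2))
    · exact (traceL _).continuous.comp_continuousOn (hW.continuousOn_fderivWithin hS le_rfl)
    · exact hu.continuousOn.inner
        ((hu.continuousOn_fderivWithin hS le_rfl).clm_apply hW.continuousOn)
  · have hdensity : rhoTilde c k γ (ρ z.1 z.2) (u z.1 z.2)
        = (1 + k ^ 2 * ρ z.1 z.2 ^ (γ - 1) / c ^ 2) / (1 - ‖u z.1 z.2‖ ^ 2 / c ^ 2)
          * ρ z.1 z.2 := by
      rw [rhoTilde, pressure_eq_mul hγ (h.density_nonneg z.1 (Ioo_subset_Icc_self hz.1) z.2)]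
      ring
    have hS : S ∈ 𝓝 z := slab_mem_nhds hz
    rw [h.fderiv_density_apply hγ hz, hdensity, divergence_eq_traceL]
    simp only [fderivWithin_of_mem_nhds hS, W]
    ring

lemma fderiv_velocity_apply_eq_zero (h : IsRegularSolution c k γ ρ₀ u₀ T ρ u) {z : ℝ × E3}
    (hz : z ∈ Ioo 0 T ×ˢ (univ : Set E3)) (h0 : ρ z.1 z.2 = 0) :
    fderiv ℝ (fun z : ℝ × E3 => u z.1 z.2) z (1, u z.1 z.2) = 0 := by
  have hd := (differentiableAt_of_contDiffOn_slab h.velocity_c1 hz).hasFDerivAt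
  have ht : HasDerivAt (fun s => u s z.2) _ z.1 :=
    hd.comp_hasDerivAt (f := fun s : ℝ => (s, z.2)) z.1
      ((hasDerivAt_id z.1).prodMk (hasDerivAt_const z.1 z.2))
  have hx : HasFDerivAt (u z.1) _ z.2 := hd.comp (f := fun y => (z.1, y)) z.2
    (hasFDerivAt_prodMk_right z.1 z.2)
  have hz' := Ioo_subset_Icc_self hz.1
  rw [← h.vacuum_eq z.1 hz' z.2 h0, hx.fderiv,
    ht.hasDerivWithinAt.derivWithin (uniqueDiffOn_Icc h.pos_time z.1 hz')]
  simp [← map_add]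

end IsRegularSolution

end Solution

/-! ### Particle paths -/

section ParticlePath

variable {E : Type*} [NormedAddCommGroup E] [NormedSpace ℝ E] {T c : ℝ} {u : ℝ → E → E}
  {X Y : ℝ → E} {A B : Set E} {w : E} {s t : ℝ}

/-- `X` is a trajectory of the velocity field `u` during `[0, T]`; the derivative is one-sided at
the two ends of the time interval. -/
def IsParticlePath (T : ℝ) (u : ℝ → E → E) (X : ℝ → E) : Prop :=
  ∀ s ∈ Icc 0 T, HasDerivWithinAt X (u s (X s)) (Icc 0 T) s

namespace IsParticlePath

lemma continuousOn (hX : IsParticlePath T u X) : ContinuousOn X (Icc 0 T) :=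
  fun s hs => (hX s hs).continuousWithinAt

lemma hasDerivAt (hX : IsParticlePath T u X) (hs : s ∈ Ioo 0 T) : HasDerivAt X (u s (X s)) s :=
  (hX s (Ioo_subset_Icc_self hs)).hasDerivAt (Icc_mem_nhds hs.1 hs.2)

lemma continuousOn_comp {F : Type*} [TopologicalSpace F] {f : ℝ × E → F}
    (hX : IsParticlePath T u X) (hf : ContinuousOn f (Icc 0 T ×ˢ univ)) :
    ContinuousOn (fun s => f (s, X s)) (Icc 0 T) :=
  hf.comp (continuousOn_id.prodMk hX.continuousOn) fun _ hs => ⟨hs, mem_univ _⟩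

lemma hasDerivAt_comp {F : Type*} [NormedAddCommGroup F] [NormedSpace ℝ F] {f : ℝ × E → F}
    (hX : IsParticlePath T u X) (hs : s ∈ Ioo 0 T) (hf : DifferentiableAt ℝ f (s, X s)) :
    HasDerivAt (fun s => f (s, X s)) (fderiv ℝ f (s, X s) (1, u s (X s))) s :=
  hf.hasFDerivAt.comp_hasDerivAt (f := fun s => (s, X s)) s
    ((hasDerivAt_id s).prodMk (hX.hasDerivAt hs))

lemma norm_sub_le (hX : IsParticlePath T u X) (hc : ∀ t ∈ Icc 0 T, ∀ x, ‖u t x‖ ≤ c)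
    (hs : s ∈ Icc 0 T) (ht : t ∈ Icc 0 T) : ‖X t - X s‖ ≤ c * T := by
  have hc0 : 0 ≤ c := (norm_nonneg _).trans (hc t ht 0)
  refine ((convex_Icc 0 T).norm_image_sub_le_of_norm_hasDerivWithin_le hX
    (fun s hs => hc s hs _) hs ht).trans (mul_le_mul_of_nonneg_left ?_ hc0)
  rw [Real.norm_eq_abs, abs_le]
  constructor <;> linarith [hs.1, hs.2, ht.1, ht.2]

end IsParticlePath

variable [FiniteDimensional ℝ E]

lemma exists_lipschitzOnWith_closedBall
    (hu : ContDiffOn ℝ 1 (fun z : ℝ × E => u z.1 z.2) (Icc 0 T ×ˢ univ)) (x : E) (M : ℝ) :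
    ∃ K, ∀ s ∈ Icc 0 T, LipschitzOnWith K (u s) (Metric.closedBall x M) := by
  obtain ⟨K, hK⟩ := (hu.mono (prod_mono_right (subset_univ _))).exists_lipschitzOnWith one_ne_zero
    ((convex_Icc 0 T).prod (convex_closedBall x M)) (isCompact_Icc.prod (isCompact_closedBall x M))
  refine ⟨K, fun s hs y hy z hz => ?_⟩
  simpa [Prod.edist_eq] using hK (mk_mem_prod hs hy) (mk_mem_prod hs hz)

lemma exists_isParticlePath
    (hu : ContDiffOn ℝ 1 (fun z : ℝ × E => u z.1 z.2) (Icc 0 T ×ˢ univ))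
    (hc : ∀ t ∈ Icc 0 T, ∀ x, ‖u t x‖ ≤ c) (ht : t ∈ Icc 0 T) (x : E) :
    ∃ X, X t = x ∧ IsParticlePath T u X := by
  have hc0 : 0 ≤ c := (norm_nonneg _).trans (hc t ht x)
  have hT : 0 ≤ T := ht.1.trans ht.2
  obtain ⟨K, hK⟩ := exists_lipschitzOnWith_closedBall hu x (c * T)
  have hPL : IsPicardLindelof u (⟨t, ht⟩ : Icc (0 : ℝ) T) x ⟨c * T, mul_nonneg hc0 hT⟩ 0
      ⟨c, hc0⟩ K :=
    { lipschitzOnWith := hK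
      continuousOn := fun y _ => hu.continuousOn.comp
        (by fun_prop : Continuous fun s : ℝ => (s, y)).continuousOn fun s hs => ⟨hs, mem_univ _⟩
      norm_le := fun s hs y _ => hc s hs y
      mul_max_le := by
        simp only [NNReal.coe_zero, sub_zero]
        exact mul_le_mul_of_nonneg_left (max_le (by linarith [ht.1]) (by linarith [ht.2])) hc0 }
  exact hPL.exists_eq_forall_mem_Icc_hasDerivWithinAt₀

lemma exists_norm_sub_le_mul_norm_sub
    (hu : ContDiffOn ℝ 1 (fun z : ℝ × E => u z.1 z.2) (Icc 0 T ×ˢ univ)) (M : ℝ) :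
    ∃ C > 0, ∀ X Y, IsParticlePath T u X → IsParticlePath T u Y →
      (∀ s ∈ Icc 0 T, ‖X s‖ ≤ M) → (∀ s ∈ Icc 0 T, ‖Y s‖ ≤ M) →
      ∀ s ∈ Icc 0 T, ∀ t ∈ Icc 0 T, ‖X t - Y t‖ ≤ C * ‖X s - Y s‖ := by
  obtain ⟨K, hK⟩ := exists_lipschitzOnWith_closedBall hu 0 M
  refine ⟨_, Real.exp_pos (K * (T - 0)), fun X Y hX hY hXM hYM s hs t ht => ?_⟩
  refine norm_le_exp_mul_norm_of_norm_deriv_le (f := fun s => X s - Y s)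
    (f' := fun s => u s (X s) - u s (Y s)) K.coe_nonneg (hX.continuousOn.sub hY.continuousOn)
    (fun s hs => (hX.hasDerivAt hs).sub (hY.hasDerivAt hs)) (fun s hs => ?_) hs ht
  have hs' := Ioo_subset_Icc_self hs
  exact (hK s hs').norm_sub_le (mem_closedBall_zero_iff.2 (hXM s hs'))
    (mem_closedBall_zero_iff.2 (hYM s hs'))

lemma IsParticlePath.eq_of_eq (hX : IsParticlePath T u X) (hY : IsParticlePath T u Y)
    (hu : ContDiffOn ℝ 1 (fun z : ℝ × E => u z.1 z.2) (Icc 0 T ×ˢ univ))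
    (hs : s ∈ Icc 0 T) (ht : t ∈ Icc 0 T) (hXY : X s = Y s) : X t = Y t := by
  obtain ⟨M, hM⟩ := isCompact_Icc.exists_bound_of_continuousOn hX.continuousOn
  obtain ⟨N, hN⟩ := isCompact_Icc.exists_bound_of_continuousOn hY.continuousOn
  obtain ⟨C, -, hC⟩ := exists_norm_sub_le_mul_norm_sub hu (max M N)
  have := hC X Y hX hY (fun s hs => (hM s hs).trans (le_max_left M N))
    (fun s hs => (hN s hs).trans (le_max_right M N)) s hs t ht
  rwa [hXY, sub_self, norm_zero, mul_zero, norm_le_zero_iff, sub_eq_zero] at this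

lemma exists_mem_frontier_of_isPreconnected {α : Type*} [TopologicalSpace α] {S A : Set α}
    (hS : IsPreconnected S) (hSA : (S ∩ A).Nonempty) (hSA' : (S \ A).Nonempty) :
    (S ∩ frontier A).Nonempty := by
  by_contra h
  have hsub : S ⊆ interior A ∪ (closure A)ᶜ := fun x hx => by
    by_contra hx'
    simp only [mem_union, mem_compl_iff, not_or, not_not] at hx'
    exact h ⟨x, hx, hx'.2, hx'.1⟩
  obtain ⟨x, hxS, hxA⟩ := hSA
  obtain ⟨y, hyS, hyA⟩ := hSA'
  obtain ⟨z, -, hzA, hz⟩ := hS _ _ isOpen_interior isClosed_closure.isOpen_compl hsub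
    ⟨x, hxS, (hsub hxS).resolve_right fun hx => hx (subset_closure hxA)⟩
    ⟨y, hyS, (hsub hyS).resolve_left fun hy => hyA (interior_subset hy)⟩
  exact hz (interior_subset_closure hzA)

/-- A path leaving the moving region would meet a boundary path, and then coincide with it. -/
lemma IsParticlePath.sub_smul_mem (hX : IsParticlePath T u X)
    (hu : ContDiffOn ℝ 1 (fun z : ℝ × E => u z.1 z.2) (Icc 0 T ×ˢ univ)) (hA : IsOpen A)
    (hline : ∀ p ∈ frontier A, IsParticlePath T u fun s => p + s • w) (hX0 : X 0 ∈ A)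
    (ht : t ∈ Icc 0 T) : X t - t • w ∈ A := by
  by_contra hXt
  have hsub : Icc 0 t ⊆ Icc 0 T := Icc_subset_Icc_right ht.2
  have hcont : ContinuousOn (fun s => X s - s • w) (Icc 0 t) :=
    (hX.continuousOn.mono hsub).sub (by fun_prop)
  obtain ⟨p, ⟨s, hs, hsp⟩, hp⟩ := exists_mem_frontier_of_isPreconnected
    (isPreconnected_Icc.image _ hcont) ⟨X 0, ⟨0, left_mem_Icc.2 ht.1, by simp⟩, hX0⟩
    ⟨_, ⟨t, right_mem_Icc.2 ht.1, rfl⟩, hXt⟩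
  have hX0p : X 0 = p := by
    simpa using hX.eq_of_eq (hline p hp) hu (hsub hs) (hsub (left_mem_Icc.2 ht.1))
      (sub_eq_iff_eq_add.1 hsp)
  rw [hA.frontier_eq, ← hX0p] at hp
  exact hp.2 hX0

/-- A particle in the collar stays within a fixed factor of its distance to the path of the nearest
boundary particle. -/
lemma exists_forall_mem_thickening_sdiff
    (hu : ContDiffOn ℝ 1 (fun z : ℝ × E => u z.1 z.2) (Icc 0 T ×ˢ univ))
    (hc : ∀ t ∈ Icc 0 T, ∀ x, ‖u t x‖ ≤ c) (hA : IsOpen A) (hAb : Bornology.IsBounded A)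
    (hB : IsOpen B) (hAB : closure A ⊆ B)
    (hline : ∀ p ∈ frontier A, IsParticlePath T u fun s => p + s • w) :
    ∃ ε > 0, ∀ t ∈ Icc 0 T, ∀ X, IsParticlePath T u X →
      X t - t • w ∈ Metric.thickening ε A \ A → X 0 ∈ B \ A := by
  obtain ⟨δ, hδ, hδB⟩ := hAb.isCompact_closure.exists_thickening_subset_open hB hAB
  obtain ⟨R, hR⟩ := hAb.closure.exists_norm_le
  obtain ⟨C, hC, hdist⟩ := exists_norm_sub_le_mul_norm_sub hu (R + 1 + T * ‖w‖ + c * T)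
  refine ⟨min 1 (δ / C), by positivity, fun t ht X hX ⟨hyN, hyA⟩ => ⟨?_, fun hX0 =>
    hyA (hX.sub_smul_mem hu hA hline hX0 ht)⟩⟩
  have hne : A.Nonempty := by
    obtain ⟨a, ha, -⟩ := Metric.mem_thickening_iff.1 hyN
    exact ⟨a, ha⟩
  obtain ⟨p, hp, hyp⟩ := exists_mem_frontier_infDist_compl_eq_dist (s := Aᶜ) hyA
    (compl_ne_univ.2 hne)
  rw [compl_compl] at hyp
  rw [frontier_compl] at hp
  have hpA : p ∈ closure A := frontier_subset_closure hp
  rw [Metric.mem_thickening_iff_infDist_lt hne, hyp, dist_eq_norm, lt_min_iff,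
    lt_div_iff₀ hC] at hyN
  have h0 : (0 : ℝ) ∈ Icc 0 T := left_mem_Icc.2 (ht.1.trans ht.2)
  have hcT : 0 ≤ c * T := (norm_nonneg _).trans (hX.norm_sub_le hc ht h0)
  have hshift : ∀ s ∈ Icc 0 T, ‖p + s • w‖ ≤ R + T * ‖w‖ := fun s hs => by
    refine (norm_add_le _ _).trans (add_le_add (hR p hpA) ?_)
    rw [norm_smul, Real.norm_of_nonneg hs.1]
    gcongr
    exact hs.2
  have hXM : ∀ s ∈ Icc 0 T, ‖X s‖ ≤ R + 1 + T * ‖w‖ + c * T := fun s hs => by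
    have hsplit : X s = (X s - X t) + (X t - t • w - p) + (p + t • w) := by abel
    rw [hsplit]
    linarith [norm_add₃_le (a := X s - X t) (b := X t - t • w - p) (c := p + t • w),
      hX.norm_sub_le hc ht hs, hshift t ht]
  have hXp := hdist X _ hX (hline p hp) hXM (fun s hs => by linarith [hshift s hs]) t ht 0 h0
  rw [zero_smul, add_zero, ← sub_sub, sub_right_comm] at hXp
  refine hδB (Metric.mem_thickening_iff.2 ⟨p, hpA, ?_⟩)
  rw [dist_eq_norm]
  linarith [hyN.2]

end ParticlePath

section Vacuum

variable {c k γ T : ℝ} {ρ₀ : E3 → ℝ} {u₀ : E3 → E3} {ρ : ℝ → E3 → ℝ} {u : ℝ → E3 → E3}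

namespace IsRegularSolution

lemma density_eq_zero_of_isParticlePath (h : IsRegularSolution c k γ ρ₀ u₀ T ρ u) (hγ : 1 ≤ γ)
    {X : ℝ → E3} (hX : IsParticlePath T u X) (h0 : ρ₀ (X 0) = 0) {t : ℝ} (ht : t ∈ Icc 0 T) :
    ρ t (X t) = 0 := by
  obtain ⟨g, hg, hρ⟩ := h.exists_fderiv_density_apply_eq_mul hγ
  obtain ⟨C, hC⟩ := isCompact_Icc.exists_bound_of_continuousOn (hX.continuousOn_comp hg)
  have h0T : (0 : ℝ) ∈ Icc 0 T := left_mem_Icc.2 h.pos_time.le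
  have hgrowth := norm_le_exp_mul_norm_of_norm_deriv_le (f := fun s => ρ s (X s))
    (f' := fun s => g (s, X s) * ρ s (X s)) ((norm_nonneg _).trans (hC 0 h0T))
    (hX.continuousOn_comp h.density_c1.continuousOn) (fun s hs => ?_) (fun s hs => ?_) h0T ht
  · simpa [h.init_density, h0] using hgrowth
  · have hz : (s, X s) ∈ Ioo 0 T ×ˢ (univ : Set E3) := ⟨hs, mem_univ _⟩
    rw [← hρ _ hz]
    exact hX.hasDerivAt_comp hs (differentiableAt_of_contDiffOn_slab h.density_c1 hz)
  · rw [norm_mul]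
    gcongr
    exact hC s (Ioo_subset_Icc_self hs)

lemma velocity_eq_of_isParticlePath (h : IsRegularSolution c k γ ρ₀ u₀ T ρ u) (hγ : 1 ≤ γ)
    {X : ℝ → E3} (hX : IsParticlePath T u X) (h0 : ρ₀ (X 0) = 0) {t : ℝ} (ht : t ∈ Icc 0 T) :
    u t (X t) = u₀ (X 0) := by
  rw [← h.init_velocity]
  refine eq_of_hasDerivAt_zero (f := fun s => u s (X s))
    (hX.continuousOn_comp h.velocity_c1.continuousOn) (fun s hs => ?_)
    (left_mem_Icc.2 h.pos_time.le) ht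
  have hz : (s, X s) ∈ Ioo 0 T ×ˢ (univ : Set E3) := ⟨hs, mem_univ _⟩
  rw [← h.fderiv_velocity_apply_eq_zero hz
    (h.density_eq_zero_of_isParticlePath hγ hX h0 (Ioo_subset_Icc_self hs))]
  exact hX.hasDerivAt_comp hs (differentiableAt_of_contDiffOn_slab h.velocity_c1 hz)

lemma norm_velocity_le (h : IsRegularSolution c k γ ρ₀ u₀ T ρ u) :
    ∀ t ∈ Icc 0 T, ∀ x, ‖u t x‖ ≤ c := fun t ht x => (h.subluminal t ht x).le

lemma isParticlePath_add_smul (h : IsRegularSolution c k γ ρ₀ u₀ T ρ u) (hγ : 1 ≤ γ) {p : E3}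
    (h0 : ρ₀ p = 0) : IsParticlePath T u fun s => p + s • u₀ p := by
  have h0T : (0 : ℝ) ∈ Icc 0 T := left_mem_Icc.2 h.pos_time.le
  obtain ⟨X, rfl, hX⟩ := exists_isParticlePath h.velocity_c1 h.norm_velocity_le h0T p
  have hline : EqOn (fun s => X 0 + s • u₀ (X 0)) X (Icc 0 T) := fun t ht => by
    have hdiff := eq_of_hasDerivAt_zero (f := fun s => X s - s • u₀ (X 0))
      (hX.continuousOn.sub (by fun_prop)) (fun s hs => ?_) h0T ht
    · simpa using (sub_eq_iff_eq_add.1 hdiff).symm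
    · refine ((hX.hasDerivAt hs).sub ((hasDerivAt_id s).smul_const (u₀ (X 0)))).congr_deriv ?_
      rw [h.velocity_eq_of_isParticlePath hγ hX h0 (Ioo_subset_Icc_self hs), one_smul, sub_self]
  intro s hs
  have hXs := (hX s hs).congr hline (hline hs)
  rwa [← hline hs] at hXs

lemma isIsolatedIn_density_comp_galilei (h : IsRegularSolution c k γ ρ₀ u₀ T ρ u) (hγ : 1 ≤ γ)
    {A B : Set E3} (hA : IsOpen A) (hAb : Bornology.IsBounded A) (hB : IsOpen B)
    (hAB : closure A ⊆ B) (hvac : ∀ x ∈ B \ A, ρ₀ x = 0) {w : E3}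
    (hw : ∀ x ∈ frontier A, u₀ x = w) :
    IsIsolatedIn T (fun z => ρ (galilei w z).1 (galilei w z).2) A := by
  have hline : ∀ p ∈ frontier A, IsParticlePath T u fun s => p + s • w := fun p hp => by
    rw [← hw p hp]
    rw [hA.frontier_eq] at hp
    exact h.isParticlePath_add_smul hγ (hvac p ⟨hAB hp.1, hp.2⟩)
  obtain ⟨ε, hε, hcollar⟩ := exists_forall_mem_thickening_sdiff h.velocity_c1 h.norm_velocity_le
    hA hAb hB hAB hline
  refine ⟨_, Metric.isOpen_thickening, Metric.closure_subset_thickening hε A, fun t ht y hy => ?_⟩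
  obtain ⟨X, hXt, hX⟩ := exists_isParticlePath h.velocity_c1 h.norm_velocity_le ht (y + t • w)
  change ρ t (y + t • w) = 0
  rw [← hXt]
  refine h.density_eq_zero_of_isParticlePath hγ hX (hvac _ (hcollar t ht X hX ?_)) ht
  rwa [hXt, add_sub_cancel_right]

end IsRegularSolution

end Vacuum

/-! ### Blow-up -/

section Trace

variable {c k γ r l : ℝ} {v w : E3}

lemma mul_norm_sq_le {V : Type*} [SeminormedAddCommGroup V] {v w : V} {c : ℝ} (hw : ‖w‖ < c) :
    (c ^ 2 - ‖w‖ ^ 2) * ‖v‖ ^ 2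
      ≤ (c ^ 4 - ‖w‖ ^ 4) / 2 + (c ^ 2 + ‖w‖ ^ 2) * ‖v - w‖ ^ 2 := by
  have hm : 0 ≤ c ^ 2 - ‖w‖ ^ 2 := sub_nonneg.2 (by gcongr)
  calc (c ^ 2 - ‖w‖ ^ 2) * ‖v‖ ^ 2 ≤ (c ^ 2 - ‖w‖ ^ 2) * (‖w‖ + ‖v - w‖) ^ 2 := by
        gcongr
        exact norm_le_norm_add_norm_sub' v w
    _ ≤ _ := by nlinarith [sq_nonneg (c ^ 2 - ‖w‖ ^ 2 - 2 * ‖w‖ * ‖v - w‖)]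

/-- Near the speed of light `ρ̃` degenerates, but then `v` is far from `w`. -/
lemma sq_mul_rhoHat_le (hv : ‖v‖ < c) (hw : ‖w‖ < c) (hr : 0 ≤ r) :
    (c ^ 2 - ‖w‖ ^ 2) ^ 2 * rhoHat c k γ r v ≤ 2 * c ^ 4 * r + 2 * c ^ 2 * pressure k γ r
      + 4 * c ^ 2 * (rhoTilde c k γ r v * ‖v - w‖ ^ 2) := by
  have hc : 0 < c := (norm_nonneg v).trans_lt hv
  have hP : 0 ≤ pressure k γ r := pressure_nonneg hr
  have hρ : 0 ≤ rhoTilde c k γ r v := rhoTilde_nonneg hv hr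
  have hwc : ‖w‖ ^ 2 ≤ c ^ 2 := by gcongr
  have hbalance : rhoTilde c k γ r v * (c ^ 2 - ‖v‖ ^ 2) = c ^ 2 * r + pressure k γ r := by
    have := rhoTilde_mul (k := k) (γ := γ) (r := r) hv
    field_simp at this
    linear_combination this
  have hhat : rhoHat c k γ r v ≤ rhoTilde c k γ r v := by
    rw [rhoHat_eq_rhoTilde_sub hv]
    exact sub_le_self _ (by positivity)
  calc (c ^ 2 - ‖w‖ ^ 2) ^ 2 * rhoHat c k γ r v
      ≤ (c ^ 2 - ‖w‖ ^ 2) ^ 2 * rhoTilde c k γ r v := by gcongr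
    _ ≤ 2 * (c ^ 2 - ‖w‖ ^ 2) * (rhoTilde c k γ r v * (c ^ 2 - ‖v‖ ^ 2))
        + 2 * (c ^ 2 + ‖w‖ ^ 2) * (rhoTilde c k γ r v * ‖v - w‖ ^ 2) := by
      linarith [mul_le_mul_of_nonneg_left (mul_norm_sq_le (v := v) hw) hρ]
    _ ≤ 2 * c ^ 2 * (c ^ 2 * r + pressure k γ r)
        + 2 * (c ^ 2 + c ^ 2) * (rhoTilde c k γ r v * ‖v - w‖ ^ 2) := by
      rw [hbalance]
      gcongr
      exact sub_le_self _ (by positivity)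
    _ = _ := by ring

lemma mul_sub_le_pressure (hγ : 1 ≤ γ) (hr : 0 ≤ r) (hl : 0 < l) :
    k ^ 2 * l ^ (γ - 1) * (r - l) ≤ pressure k γ r := by
  rcases le_total r l with h | h
  · exact (mul_nonpos_of_nonneg_of_nonpos (by positivity) (by linarith)).trans (pressure_nonneg hr)
  · rw [pressure_eq_mul hγ hr, mul_comm r]
    have hpow : l ^ (γ - 1) ≤ r ^ (γ - 1) := Real.rpow_le_rpow hl.le h (sub_nonneg.2 hγ)
    gcongr
    exact sub_le_self r hl.le

lemma exists_mul_rhoHat_sub_le (hk : k ≠ 0) (hγ : 1 ≤ γ) (hw : ‖w‖ < c) (hl : 0 < l) :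
    ∃ ν > 0, ∀ r v, 0 ≤ r → ‖v‖ < c → ν * (rhoHat c k γ r v - l)
      ≤ rhoTilde c k γ r v * ‖v - w‖ ^ 2 + 2 * pressure k γ r := by
  have hc : 0 < c := (norm_nonneg w).trans_lt hw
  have hm : 0 < c ^ 2 - ‖w‖ ^ 2 := sub_pos.2 (by gcongr)
  set m := c ^ 2 - ‖w‖ ^ 2
  set l' := m ^ 2 * l / (2 * c ^ 4)
  have hl' : 0 < l' := by positivity
  have hml : m ^ 2 * l = 2 * c ^ 4 * l' := by
    simp only [l']
    field_simp
  set q := k ^ 2 * l' ^ (γ - 1)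
  have hq : 0 < q := by positivity
  set K := 4 * c ^ 2 + 2 * c ^ 4 / q
  refine ⟨m ^ 2 / K, by positivity, fun r v hr hv => ?_⟩
  have hP : 0 ≤ pressure k γ r := pressure_nonneg hr
  have hkin : 0 ≤ rhoTilde c k γ r v * ‖v - w‖ ^ 2 :=
    mul_nonneg (rhoTilde_nonneg hv hr) (by positivity)
  have hrl : r - l' ≤ pressure k γ r / q := by
    rw [le_div_iff₀' hq]
    exact mul_sub_le_pressure hγ hr hl'
  rw [div_mul_eq_mul_div, div_le_iff₀ (by positivity)]
  calc m ^ 2 * (rhoHat c k γ r v - l)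
      ≤ 2 * c ^ 4 * (r - l') + 2 * c ^ 2 * pressure k γ r
        + 4 * c ^ 2 * (rhoTilde c k γ r v * ‖v - w‖ ^ 2) := by
        linarith [sq_mul_rhoHat_le (k := k) (γ := γ) hv hw hr]
    _ ≤ 2 * c ^ 4 * (pressure k γ r / q) + 2 * c ^ 2 * pressure k γ r
        + 4 * c ^ 2 * (rhoTilde c k γ r v * ‖v - w‖ ^ 2) := by gcongr
    _ = K * (rhoTilde c k γ r v * ‖v - w‖ ^ 2 + 2 * pressure k γ r)
        - (6 * c ^ 2 + 2 * c ^ 4 / q) * pressure k γ r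
        - 2 * c ^ 4 / q * (rhoTilde c k γ r v * ‖v - w‖ ^ 2) := by
        simp only [K]
        ring
    _ ≤ (rhoTilde c k γ r v * ‖v - w‖ ^ 2 + 2 * pressure k γ r) * K := by
        rw [sub_sub, mul_comm]
        exact sub_le_self _ (by positivity)

end Trace

lemma measureReal_pos_of_setIntegral_ne_zero {α F : Type*} [MeasurableSpace α]
    [NormedAddCommGroup F] [NormedSpace ℝ F] {μ : Measure α} {s : Set α} {f : α → F}
    (hs : μ s ≠ ⊤) (hf : ∫ x in s, f x ∂μ ≠ 0) : 0 < μ.real s :=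
  ENNReal.toReal_pos (fun h => hf (setIntegral_measure_zero f h)) hs

lemma nonempty_frontier_of_isBounded {V : Type*} [NormedAddCommGroup V] [NormedSpace ℝ V]
    [Nontrivial V] {s : Set V} (hs : Bornology.IsBounded s) (hne : s.Nonempty) :
    (frontier s).Nonempty :=
  nonempty_frontier_iff.2 ⟨hne, fun h => NormedSpace.unbounded_univ ℝ V (h ▸ hs)⟩

section Blowup

variable {c k γ T R ν l : ℝ} {ρ₀ : E3 → ℝ} {u₀ : E3 → E3} {ρ : ℝ → E3 → ℝ} {u : ℝ → E3 → E3}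
  {A B : Set E3} {w : E3}

/-- The energy current in coordinates moving with velocity `w`. -/
def movingEnergyCurrent (c k γ : ℝ) (ρ : ℝ → E3 → ℝ) (u : ℝ → E3 → E3) (w : E3)
    (z : ℝ × E3) : ℝ × E3 :=
  (galilei w).symm (energyCurrent c k γ ρ u (galilei w z))

/-- The current of the `i`-th component of the momentum relative to the velocity `w`, in
coordinates moving with velocity `w`. -/
def movingMomentumCurrent (c k γ : ℝ) (ρ : ℝ → E3 → ℝ) (u : ℝ → E3 → E3) (w : E3) (i : Fin 3)
    (z : ℝ × E3) : ℝ × E3 :=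
  (galilei w).symm
    (momentumCurrent c k γ ρ u i (galilei w z) - w i • energyCurrent c k γ ρ u (galilei w z))

lemma movingMomentumCurrent_fst (i : Fin 3) (z : ℝ × E3) :
    (movingMomentumCurrent c k γ ρ u w i z).1 = (movingEnergyCurrent c k γ ρ u w z).2 i := by
  simp [movingMomentumCurrent, movingEnergyCurrent, galilei_symm_apply, momentumCurrent,
    energyCurrent, mul_comm]

lemma sum_movingMomentumCurrent_snd {z : ℝ × E3}
    (hz : ‖u (galilei w z).1 (galilei w z).2‖ < c) :
    ∑ i, (movingMomentumCurrent c k γ ρ u w i z).2 i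
      = rhoTilde c k γ (ρ (galilei w z).1 (galilei w z).2) (u (galilei w z).1 (galilei w z).2)
          * ‖u (galilei w z).1 (galilei w z).2 - w‖ ^ 2
        + (3 - ‖w‖ ^ 2 / c ^ 2) * pressure k γ (ρ (galilei w z).1 (galilei w z).2) := by
  simp only [movingMomentumCurrent, momentumCurrent, Prod.smul_mk, smul_eq_mul, mul_one, mul_zero,
    Prod.mk_add_mk, add_zero, energyCurrent, rhoHat_eq_rhoTilde_sub hz, Prod.mk_sub_mk,
    galilei_symm_apply, PiLp.sub_apply, PiLp.add_apply, PiLp.smul_apply, PiLp.single_eq_same,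
    Finset.sum_sub_distrib, Fin.sum_univ_three, EuclideanSpace.norm_sq_eq, Real.norm_eq_abs, sq_abs]
  ring

namespace IsRegularSolution

lemma mul_sq_time_le (h : IsRegularSolution c k γ ρ₀ u₀ T ρ u) (hγ : 1 ≤ γ) (hA : IsOpen A)
    (hAR : A ⊆ Metric.closedBall 0 R) (hB : IsOpen B) (hAB : closure A ⊆ B)
    (hvac : ∀ x ∈ B \ A, ρ₀ x = 0) (hw : ∀ x ∈ frontier A, u₀ x = w) (hwc : ‖w‖ < c)
    (hν : ∀ r v, 0 ≤ r → ‖v‖ < c → ν * (rhoHat c k γ r v - l)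
      ≤ rhoTilde c k γ r v * ‖v - w‖ ^ 2 + 2 * pressure k γ r) :
    ν * ((∫ y in A, rhoHat c k γ (ρ₀ y) (u₀ y)) - l * volume.real A) * T ^ 2
      ≤ 4 * (R ^ 2 * ∫ y in A, rhoHat c k γ (ρ₀ y) (u₀ y)) := by
  have hisol := h.isIsolatedIn_density_comp_galilei hγ hA (Metric.isBounded_closedBall.subset hAR)
    hB hAB hvac hw
  have henergy := h.isConservedCurrent_energyCurrent hγ
  have henergy0 : ∀ z : ℝ × E3, ρ z.1 z.2 = 0 → energyCurrent c k γ ρ u z = 0 := fun z hz => by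
    simp [energyCurrent, hz, rhoHat, rhoTilde_zero hγ, pressure_zero hγ]
  have hmomentum0 : ∀ i, ∀ z : ℝ × E3, ρ z.1 z.2 = 0 → momentumCurrent c k γ ρ u i z = 0 :=
    fun i z hz => by simp [momentumCurrent, hz, rhoTilde_zero hγ, pressure_zero hγ]
  have hvirial := mul_sq_le_of_virial (V := movingEnergyCurrent c k γ ρ u w)
    (J := movingMomentumCurrent c k γ ρ u w) (ν := ν) (l := l) (henergy.comp_galilei w)
    (hisol.of_imp fun z _ hz => by rw [movingEnergyCurrent, henergy0 _ hz, map_zero])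
    (fun i => ((h.isConservedCurrent_momentumCurrent hγ i).sub
      (henergy.const_smul (w i))).comp_galilei w)
    (fun i => hisol.of_imp fun z _ hz => by
      rw [movingMomentumCurrent, henergy0 _ hz, hmomentum0 i _ hz]
      simp)
    movingMomentumCurrent_fst hA.measurableSet hAR h.pos_time.le
    (fun z hz => ?_) (fun z hz => ?_)
  · simpa [movingEnergyCurrent, galilei_apply, galilei_symm_apply, energyCurrent,
      h.init_density, h.init_velocity] using hvirial
  · exact rhoHat_nonneg (h.subluminal z.1 hz.1 _) (h.density_nonneg z.1 hz.1 _)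
  · have hv := h.subluminal z.1 hz.1 (z.2 + z.1 • w)
    have hr := h.density_nonneg z.1 hz.1 (z.2 + z.1 • w)
    rw [sum_movingMomentumCurrent_snd hv]
    refine (hν _ _ hr hv).trans ?_
    have hratio := one_sub_norm_sq_div_pos hwc
    exact add_le_add le_rfl (mul_le_mul_of_nonneg_right (by linarith) (pressure_nonneg hr))

lemma norm_init_velocity_lt (h : IsRegularSolution c k γ ρ₀ u₀ T ρ u) (x : E3) : ‖u₀ x‖ < c := by
  rw [← h.init_velocity]
  exact h.subluminal 0 (left_mem_Icc.2 h.pos_time.le) x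

lemma setIntegral_density_le_setIntegral_rhoHat (h : IsRegularSolution c k γ ρ₀ u₀ T ρ u)
    (hγ : 1 ≤ γ) (hAb : Bornology.IsBounded A) :
    ∫ y in A, ρ₀ y ≤ ∫ y in A, rhoHat c k γ (ρ₀ y) (u₀ y) := by
  have h0T : (0 : ℝ) ∈ Icc 0 T := left_mem_Icc.2 h.pos_time.le
  have hρ := continuous_slice h.density_c1.continuousOn h0T
  have henergy := continuous_slice
    (h.isConservedCurrent_energyCurrent hγ).contDiffOn.continuousOn.fst h0T
  simp only [energyCurrent, h.init_density, h.init_velocity] at hρ henergy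
  refine setIntegral_mono (integrableOn_of_isBounded hρ hAb)
    (integrableOn_of_isBounded henergy hAb) fun y => ?_
  exact le_rhoHat (h.norm_init_velocity_lt y) (h.init_density y ▸ h.density_nonneg 0 h0T y)

end IsRegularSolution

lemma maximalTime_lt_top (h : ∀ T ρ u, IsRegularSolution c k γ ρ₀ u₀ T ρ u →
      ∃ b, ∀ T' ρ' u', IsRegularSolution c k γ ρ₀ u₀ T' ρ' u' → T' ≤ b) :
    maximalTime c k γ ρ₀ u₀ < ⊤ := by
  by_cases hex : ∃ T ρ u, IsRegularSolution c k γ ρ₀ u₀ T ρ u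
  · obtain ⟨T, ρ, u, hT⟩ := hex
    obtain ⟨b, hb⟩ := h T ρ u hT
    refine lt_of_le_of_lt (sSup_le ?_) (ENNReal.ofReal_lt_top (r := b))
    rintro _ ⟨T', rfl, ρ', u', hT'⟩
    exact ENNReal.ofReal_le_ofReal (hb T' ρ' u' hT')
  · refine lt_of_le_of_lt (sSup_le ?_) ENNReal.zero_lt_top
    rintro _ ⟨T, -, ρ, u, hT⟩
    exact (hex ⟨T, ρ, u, hT⟩).elim

end Blowup

end RelEuler

end

theorem mainTheorem3_general {c k γ : ℝ} (hk : k ≠ 0) (hγ : 1 ≤ γ)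
    {ρ₀ : RelEuler.E3 → ℝ} {u₀ : RelEuler.E3 → RelEuler.E3} {A₀ B₀ : Set RelEuler.E3}
    (hA : IsOpen A₀) (hAb : Bornology.IsBounded A₀) (hB : IsOpen B₀) (hAB : closure A₀ ⊆ B₀)
    (hvac : ∀ x ∈ B₀ \ A₀, ρ₀ x = 0) (hmass : 0 < ∫ x in A₀, ρ₀ x) {w : RelEuler.E3}
    (hw : ∀ x ∈ frontier A₀, u₀ x = w) :
    RelEuler.maximalTime c k γ ρ₀ u₀ < ⊤ := by
  refine RelEuler.maximalTime_lt_top fun T ρ u h => ?_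
  obtain ⟨R, hR⟩ := hAb.subset_closedBall 0
  have hvol := RelEuler.measureReal_pos_of_setIntegral_ne_zero hAb.measure_lt_top.ne hmass.ne'
  obtain ⟨x, hx⟩ := RelEuler.nonempty_frontier_of_isBounded hAb
    (MeasureTheory.nonempty_of_measureReal_ne_zero hvol.ne')
  have hwc : ‖w‖ < c := hw x hx ▸ h.norm_init_velocity_lt x
  have henergy := hmass.trans_le (h.setIntegral_density_le_setIntegral_rhoHat hγ hAb)
  set E := ∫ y in A₀, RelEuler.rhoHat c k γ (ρ₀ y) (u₀ y)
  set V := MeasureTheory.volume.real A₀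
  obtain ⟨ν, hν, hbound⟩ := RelEuler.exists_mul_rhoHat_sub_le hk hγ hwc
    (show 0 < E / (2 * V) by positivity)
  refine ⟨√(8 * R ^ 2 / ν), fun T' ρ' u' h' => Real.le_sqrt_of_sq_le ?_⟩
  have htime := h'.mul_sq_time_le hγ hA hR hB hAB hvac hw hwc hbound
  have hhalf : E - E / (2 * V) * V = E / 2 := by field_simp; ring
  rw [hhalf] at htime
  rw [le_div_iff₀ hν]
  refine le_of_mul_le_mul_right ?_ henergy
  linarith

theorem mainTheorem3 (c k γ : ℝ) (hc : 0 < c) (hk : 0 < k) (hγ : 1 ≤ γ)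
    (ρ₀ : RelEuler.E3 → ℝ) (u₀ : RelEuler.E3 → RelEuler.E3) (A₀ B₀ : Set RelEuler.E3)
    (hAB : RelEuler.IsIsolatedMassGroup c k γ ρ₀ u₀ A₀ B₀) :
    RelEuler.maximalTime c k γ ρ₀ u₀ < ⊤ :=
  have ⟨_, _, hBR⟩ := hAB.bounded
  have ⟨_, hw⟩ := hAB.velocity_const
  mainTheorem3_general hk.ne' hγ hAB.isOpen_A
    (Metric.isBounded_ball.subset (subset_closure.trans (hAB.closure_subset.trans hBR)))
    hAB.isOpen_B hAB.closure_subset hAB.vacuum hAB.mass_pos hw
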